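/- Let $\Delta\ge 0$, let $\mathcal X^n=C([-\Delta,0];\mathbb R^n)$ with the norm $\|\phi\|=\max_{\tau\in[-\Delta,0]}|\phi(\tau)|$ ($|\cdot|$ the Euclidean norm), and let $f:\mathcal X^n\times\mathbb R^m\to\mathbb R^n$ be Lipschitz on bounded sets with $f(0,0)=0$. Consider the time-delay system $\dot x(t)=f(x_t,u(t))$, where $x_t(\tau)=x(t+\tau)$ for $\tau\in[-\Delta,0]$ and the inputs $u:[0,\infty)\to\mathbb R^m$ are Lebesgue measurable and locally essentially bounded; solutions are locally absolutely continuous and satisfy the equation almost everywhere. A function $[0,\infty)\to[0,\infty)$ is of class $\mathcal N$ if it is continuous, non-decreasing and zero at $0$; of class $\mathcal K$ if it is continuous, strictly increasing and zero at $0$; of class $\mathcal K_\infty$ if it is of class $\mathcal K$ and unbounded. A function $\beta:[0,\infty)^2\to[0,\infty)$ is of class $\mathcal{KL}$ if $\beta(\cdot,t)$ is of class $\mathcal K$ for each $t\ge0$ and $\beta(s,\cdot)$ is continuous, non-increasing and tends to $0$ at infinity for each $s\ge 0$. For $V:\mathcal X^n\to[0,\infty)$ continuous, $\phi\in\mathcal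 X^n$ and $w\in\mathbb R^n$, let $$D^+V(\phi,w)=\limsup_{h\to0^+}\frac{V(\phi_{h,w})-V(\phi)}{h}\in[-\infty,+\infty],$$ where, for $s\in[-\Delta,0]$, $\phi_{h,w}(s)=\phi(s+h)$ if $s<-h$ and $\phi_{h,w}(s)=\phi(0)+(h+s)w$ if $s\ge -h$. Theorem (ISS through point-wise dissipation rate). Let $V:\mathcal X^n\to[0,\infty)$ be a Lyapunov–Krasovskii functional candidate, that is, $V$ is Lipschitz on bounded sets and lies between a $\mathcal K_\infty$ function of $|\phi(0)|$ and a $\mathcal K_\infty$ function of $\|\phi\|$. Suppose that there are $\underline\alpha,\overline\alpha_1,\overline\alpha_2,\overline\alpha_3\in\mathcal K_\infty$ such that, for all $\phi\in\mathcal X^n$, $$\underline\alpha(|\phi(0)|)\le V(\phi)\le\overline\alpha_1(|\phi(0)|)+\overline\alpha_2\left(\int_{-\Delta}^0\overline\alpha_3(|\phi(\tau)|)\,d\tau\right),$$ and that there are $\alpha\in\mathcal K_\infty$ and $\gamma\in\mathcal N$ such that, for all $\phi\in\mathcal X^n$ and all $v\in\mathbb R^m$, $$D^+V(\phi,f(\phi,v))\le-\alpha(|\phi(0)|)+\gamma(|v|).$$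 If $$\liminf_{s\to+\infty}\frac{\alpha(s)}{\overline\alpha_3(s)}>0$$ (the value $+\infty$ being allowed), then the system is input-to-state stable (ISS): there exist $\beta\in\mathcal{KL}$ and $\mu\in\mathcal N$ such that, for every initial state $x_0\in\mathcal X^n$ and every input $u$, the solution $x(\cdot,x_0,u)$ exists on $[0,\infty)$ and satisfies $$|x(t,x_0,u)|\le\beta(\|x_0\|,t)+\mu\left(\operatorname*{ess\,sup}_{s\in[0,t]}|u(s)|\right)\qquad\text{for all }t\ge0.$$ -/

import Mathlib

open MeasureTheory Filter Topology
open scoped NNReal ENNReal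

namespace TimeDelay

noncomputable section

/-! ### Comparison functions

Functions from `[0, ∞)` to `[0, ∞)` are represented by functions `ℝ → ℝ` of which only the
values on `[0, ∞)` matter. -/

/-- Class `N`: continuous, non-decreasing and zero at zero. -/
structure ClassN (a : ℝ → ℝ) : Prop where
  continuousOn : ContinuousOn a (Set.Ici 0)
  map_zero : a 0 = 0
  monotoneOn : MonotoneOn a (Set.Ici 0)

/-- Class `K`: continuous, zero at zero and (strictly) increasing; such a function is
positive on `(0, ∞)`. -/
structure ClassK (a : ℝ → ℝ) : Prop where
  continuousOn : ContinuousOn a (Set.Ici 0)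
  map_zero : a 0 = 0
  strictMonoOn : StrictMonoOn a (Set.Ici 0)

/-- Class `K∞`: class `K` and unbounded. -/
structure ClassKInf (a : ℝ → ℝ) : Prop extends ClassK a where
  tendsto_atTop : Tendsto a atTop atTop

/-- Class `L`: nonnegative, continuous, non-increasing and tending to zero. -/
structure ClassL (l : ℝ → ℝ) : Prop where
  nonneg : ∀ t, 0 ≤ t → 0 ≤ l t
  continuousOn : ContinuousOn l (Set.Ici 0)
  antitoneOn : AntitoneOn l (Set.Ici 0)
  tendsto_zero : Tendsto l atTop (𝓝 0)

/-- Class `KL`: class `K` in the first variable, class `L` in the second one. -/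
structure ClassKL (b : ℝ → ℝ → ℝ) : Prop where
  classK : ∀ t, 0 ≤ t → ClassK fun s => b s t
  classL : ∀ s, 0 ≤ s → ClassL (b s)

/-! ### State space -/

/-- `ℝⁿ` with the Euclidean norm. -/
abbrev Vec (n : ℕ) : Type := EuclideanSpace ℝ (Fin n)

/-- The state space: continuous functions `[-Δ, 0] → ℝⁿ` with the supremum norm. -/
abbrev History (Δ : ℝ≥0) (n : ℕ) : Type := C(Set.Icc (-(Δ : ℝ)) 0, Vec n)

theorem neg_delay_le (Δ : ℝ≥0) : -(Δ : ℝ) ≤ 0 := neg_nonpos.mpr Δ.coe_nonneg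

variable {Δ : ℝ≥0} {n m : ℕ}

/-- The current value `φ(0)`. -/
def current (φ : History Δ n) : Vec n := φ ⟨0, neg_delay_le Δ, le_rfl⟩

/-- The value `φ(τ)` for `τ ∈ [-Δ, 0]`, extended constantly to other real `τ`. -/
def value (φ : History Δ n) (τ : ℝ) : Vec n :=
  φ (Set.projIcc (-(Δ : ℝ)) 0 (neg_delay_le Δ) τ)

theorem value_of_mem (φ : History Δ n) {τ : ℝ} (hτ : τ ∈ Set.Icc (-(Δ : ℝ)) 0) :
    value φ τ = φ ⟨τ, hτ⟩ := by
  rw [value, Set.projIcc_of_mem]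

theorem continuous_value (φ : History Δ n) : Continuous (value φ) :=
  φ.continuous.comp continuous_projIcc

open Classical in
/-- The history segment `x_t : τ ↦ x(t + τ)`, `τ ∈ [-Δ, 0]`, of a function `x` which is
continuous on `[t - Δ, t]` (a default value is used for other `x`). -/
def segment (Δ : ℝ≥0) (x : ℝ → Vec n) (t : ℝ) : History Δ n :=
  if h : Continuous fun τ : Set.Icc (-(Δ : ℝ)) 0 => x (t + τ) then ⟨_, h⟩ else 0

theorem segment_apply {x : ℝ → Vec n} {t : ℝ} (hx : ContinuousOn x (Set.Icc (t - Δ) t))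
    (τ : Set.Icc (-(Δ : ℝ)) 0) : segment Δ x t τ = x (t + τ) := by
  have h : Continuous fun τ : Set.Icc (-(Δ : ℝ)) 0 => x (t + τ) := by
    refine hx.comp_continuous (by fun_prop) fun σ => ?_
    have h1 := σ.2.1
    have h2 := σ.2.2
    constructor <;> linarith
  rw [segment, dif_pos h]
  rfl

/-! ### Systems, inputs and solutions of `x'(t) = f(x_t, u(t))` -/

/-- A map `f` of a history and an input value is Lipschitz on bounded sets. -/
def FieldLipschitzOnBounded (f : History Δ n → Vec m → Vec n) : Prop :=
  ∀ r : ℝ, 0 < r → ∃ L : ℝ, 0 < L ∧ ∀ (φ₁ φ₂ : History Δ n) (v₁ v₂ : Vec m),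
    ‖φ₁‖ ≤ r → ‖φ₂‖ ≤ r → ‖v₁‖ ≤ r → ‖v₂‖ ≤ r →
      ‖f φ₁ v₁ - f φ₂ v₂‖ ≤ L * (‖φ₁ - φ₂‖ + ‖v₁ - v₂‖)

/-- A functional `V` is Lipschitz on bounded sets. -/
def LipschitzOnBounded (V : History Δ n → ℝ) : Prop :=
  ∀ r : ℝ, 0 < r → ∃ L : ℝ, 0 < L ∧ ∀ φ₁ φ₂ : History Δ n,
    ‖φ₁‖ ≤ r → ‖φ₂‖ ≤ r → |V φ₁ - V φ₂| ≤ L * ‖φ₁ - φ₂‖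

/-- Input signals: Lebesgue measurable and locally essentially bounded on `[0, ∞)`. The values
at negative times are irrelevant. -/
def IsInput (u : ℝ → Vec m) : Prop :=
  ∀ T : ℝ, 0 ≤ T → MemLp u ∞ (volume.restrict (Set.Icc 0 T))

/-- The essential supremum norm of `u` on `[0, t]`; finite for every input signal. -/
def inputNorm (u : ℝ → Vec m) (t : ℝ) : ℝ :=
  (eLpNorm u ∞ (volume.restrict (Set.Icc 0 t))).toReal

/-- `x` is a solution on `[0, T)`, `0 < T ≤ ∞`, with initial state `φ` and input `u`: it is
continuous on `[-Δ, T)`, coincides with `φ` on `[-Δ, 0]`, and satisfies the integrated equation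
on `[0, T)`, that is, it is locally absolutely continuous on `[0, T)` and solves the
differential equation almost everywhere. -/
structure IsSolution (f : History Δ n → Vec m → Vec n) (φ : History Δ n) (u : ℝ → Vec m)
    (T : EReal) (x : ℝ → Vec n) : Prop where
  horizon_pos : 0 < T
  continuousOn : ContinuousOn x {t : ℝ | -(Δ : ℝ) ≤ t ∧ (t : EReal) < T}
  initial : ∀ τ : Set.Icc (-(Δ : ℝ)) 0, x τ = φ τ
  integrable : ∀ t : ℝ, 0 ≤ t → (t : EReal) < T →
    IntervalIntegrable (fun s => f (segment Δ x s) (u s)) volume 0 t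
  integral_eq : ∀ t : ℝ, 0 ≤ t → (t : EReal) < T →
    x t = current φ + ∫ s in (0 : ℝ)..t, f (segment Δ x s) (u s)

/-- Input-to-state stability: for every initial state and every input a solution exists on
`[0, ∞)`, and every solution obeys, on its whole interval of definition, the estimate
`|x(t)| ≤ β(‖x₀‖, t) + μ(‖u‖ on [0, t])`. -/
def ISS (f : History Δ n → Vec m → Vec n) : Prop :=
  ∃ (β : ℝ → ℝ → ℝ) (μ : ℝ → ℝ), ClassKL β ∧ ClassN μ ∧
    ∀ (φ : History Δ n) (u : ℝ → Vec m), IsInput u →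
      (∃ x : ℝ → Vec n, IsSolution f φ u ⊤ x) ∧
      ∀ (T : EReal) (x : ℝ → Vec n), IsSolution f φ u T x →
        ∀ t : ℝ, 0 ≤ t → (t : EReal) < T → ‖x t‖ ≤ β ‖φ‖ t + μ (inputNorm u t)

/-! ### Lyapunov–Krasovskii functionals -/

/-- Lyapunov–Krasovskii functional candidate. -/
structure IsLKF (V : History Δ n → ℝ) : Prop where
  nonneg : ∀ φ, 0 ≤ V φ
  lipschitz : LipschitzOnBounded V
  bounds : ∃ a b : ℝ → ℝ, ClassKInf a ∧ ClassKInf b ∧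
    ∀ φ : History Δ n, a ‖current φ‖ ≤ V φ ∧ V φ ≤ b ‖φ‖

/-- The shifted history `φ_{h,w}`: for `h ≥ 0` its value at `s` is `φ(s + h)` if `s < -h` and
`φ(0) + (h + s) w` if `-h ≤ s`, see `shift_of_lt` and `shift_of_le`. -/
def shift (φ : History Δ n) (w : Vec n) (h : ℝ) : History Δ n where
  toFun s := value φ (s + h) + max ((s : ℝ) + h) 0 • w
  continuous_toFun := by
    have := continuous_value φ
    fun_prop

theorem shift_of_lt (φ : History Δ n) (w : Vec n) {h : ℝ} (h0 : 0 ≤ h)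
    (s : Set.Icc (-(Δ : ℝ)) 0) (hs : (s : ℝ) < -h) :
    shift φ w h s = φ ⟨s + h, by linarith [s.2.1], by linarith⟩ := by
  change value φ (s + h) + max ((s : ℝ) + h) 0 • w = _
  rw [value_of_mem φ ⟨by linarith [s.2.1], by linarith⟩, max_eq_right (by linarith), zero_smul,
    add_zero]

theorem shift_of_le (φ : History Δ n) (w : Vec n) {h : ℝ}
    (s : Set.Icc (-(Δ : ℝ)) 0) (hs : -h ≤ (s : ℝ)) :
    shift φ w h s = current φ + (h + s) • w := by
  change value φ (s + h) + max ((s : ℝ) + h) 0 • w = _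
  rw [value, Set.projIcc_of_right_le _ (by linarith), max_eq_left (by linarith), add_comm (s : ℝ) h]
  rfl

/-- Driver's derivative `D⁺V(φ, w)`, the upper right limit of `(V(φ_{h,w}) - V(φ)) / h` as
`h → 0⁺`, an extended real number. -/
def driverDeriv (V : History Δ n → ℝ) (φ : History Δ n) (w : Vec n) : EReal :=
  limsup (fun h : ℝ => (((V (shift φ w h) - V φ) / h : ℝ) : EReal)) (𝓝[>] 0)

end

end TimeDelay

/-!
# Input-to-state stability from a point-wise dissipation rate

The functional `V` is shown to decrease along solutions over windows of length `Δ + 1`, in terms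
of the amount by which it decreases, and this suffices for uniform stability and attraction.

**Integrated dissipation.** For a measurable input and a merely continuous initial state, the
function `t ↦ V (x_t)` need not be absolutely continuous, so an almost everywhere bound on its Dini
derivative does not control its increments. However, the dissipation inequality for the input value
`0`, together with the local boundedness of the speed of solutions, bounds the upper right Dini
derivative at *every* time, and by `sub_le_integral_of_dini` the almost everywhere bound can then
be integrated. This gives `dissipation_of_integral_eq`:
`V (x_t) + ∫ r in s..t, α |x r| ≤ V (x_s) + G (t - s)`, where `G` is `γ` of the input norm.

**Windows.** The growth condition at infinity, and the positivity of `α` away from zero, yield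
`a₃ ≤ ε + C_ε α` for every `ε > 0`. Hence `V φ ≤ σ D` for some class `N` function `σ`, whenever
`α |φ 0| ≤ D` and the integral of `α |φ|` is at most `D` (`exists_coercive_bound`). If the
dissipation over `[t - Δ - 1, t]` is `D`, then both quantities are at most `D` for the segment at a
suitable time in `[t - 1, t]`, so `V (x_t) ≤ σ D + G`, where
`D ≤ V (x_{t - Δ - 1}) - V (x_t) + G (Δ + 1)` (`le_of_window`). It follows that over each window `V`
either decreases by a fixed amount or ends below a level given by the input and an arbitrarily
small constant (`window_decay`). This is a uniform estimate for all solutions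
(`exists_uniform_estimate`), from which `β` is obtained by `exists_classKL`.

**Existence.** The equation with the state argument of `f` truncated has a global solution by Picard
iteration (`exists_global_integral_eq`). If the truncation level lies above the a priori bound
just described, then the solution never reaches that level, and so solves the original equation
(`exists_global_solution`).
-/

namespace TimeDelay

/-! ### Comparison functions from ε-δ bounds -/

theorem ClassN.nonneg {a : ℝ → ℝ} (ha : ClassN a) {s : ℝ} (hs : 0 ≤ s) : 0 ≤ a s :=
  ha.map_zero ▸ ha.monotoneOn Set.self_mem_Ici hs hs

theorem ClassN.mono {a : ℝ → ℝ} (ha : ClassN a) {s t : ℝ} (hs : 0 ≤ s) (hst : s ≤ t) :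
    a s ≤ a t := ha.monotoneOn hs (hs.trans hst) hst

theorem ClassK.classN {a : ℝ → ℝ} (ha : ClassK a) : ClassN a :=
  ⟨ha.continuousOn, ha.map_zero, ha.strictMonoOn.monotoneOn⟩

theorem ClassKInf.classN {a : ℝ → ℝ} (ha : ClassKInf a) : ClassN a := ha.toClassK.classN

theorem ClassK.pos {a : ℝ → ℝ} (ha : ClassK a) {s : ℝ} (hs : 0 < s) : 0 < a s :=
  ha.map_zero ▸ ha.strictMonoOn Set.self_mem_Ici hs.le hs

theorem ClassN.comp {a b : ℝ → ℝ} (ha : ClassN a) (hb : ClassN b) : ClassN fun s => a (b s) where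
  continuousOn := ha.continuousOn.comp hb.continuousOn fun _ hs => hb.nonneg hs
  map_zero := by rw [hb.map_zero, ha.map_zero]
  monotoneOn _ hs _ ht hst := ha.mono (hb.nonneg hs) (hb.monotoneOn hs ht hst)

theorem ClassN.add {a b : ℝ → ℝ} (ha : ClassN a) (hb : ClassN b) :
    ClassN fun s => a s + b s where
  continuousOn := ha.continuousOn.add hb.continuousOn
  map_zero := by rw [hb.map_zero, ha.map_zero, add_zero]
  monotoneOn := ha.monotoneOn.add hb.monotoneOn

theorem ClassN.const_mul {a : ℝ → ℝ} (ha : ClassN a) {c : ℝ} (hc : 0 ≤ c) :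
    ClassN fun s => c * a s where
  continuousOn := continuousOn_const.mul ha.continuousOn
  map_zero := by rw [ha.map_zero, mul_zero]
  monotoneOn _ hs _ ht hst := mul_le_mul_of_nonneg_left (ha.monotoneOn hs ht hst) hc

/-- Weak triangle inequality for monotone comparison functions. -/
theorem ClassN.map_add_le {a : ℝ → ℝ} (ha : ClassN a) {s t : ℝ} (hs : 0 ≤ s) (ht : 0 ≤ t) :
    a (s + t) ≤ a (2 * s) + a (2 * t) := by
  have h1 := ha.nonneg (s := 2 * s) (by linarith)
  have h2 := ha.nonneg (s := 2 * t) (by linarith)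
  rcases le_total s t with h | h
  · have := ha.mono (s := s + t) (t := 2 * t) (by linarith) (by linarith)
    linarith
  · have := ha.mono (s := s + t) (t := 2 * s) (by linarith) (by linarith)
    linarith

theorem ClassN.tendsto_zero {a : ℝ → ℝ} (ha : ClassN a) : Tendsto a (𝓝[≥] 0) (𝓝 0) := by
  have := ha.continuousOn 0 Set.self_mem_Ici
  rwa [ContinuousWithinAt, ha.map_zero] at this

/-- A class `N` function is small on a neighbourhood of zero. -/
theorem ClassN.exists_le {a : ℝ → ℝ} (ha : ClassN a) {ε : ℝ} (hε : 0 < ε) :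
    ∃ δ, 0 < δ ∧ ∀ s, 0 ≤ s → s ≤ δ → a s ≤ ε := by
  have h := ha.tendsto_zero.eventually (eventually_le_nhds hε)
  obtain ⟨δ, hδ, hsub⟩ := mem_nhdsGE_iff_exists_Icc_subset.mp h
  exact ⟨δ, hδ, fun s hs hsδ => hsub ⟨hs, hsδ⟩⟩

/-- The mean of `g` over `[s, 2s]`, written so that it equals `g 0` at `s = 0`. -/
noncomputable def average (g : ℝ → ℝ) (s : ℝ) : ℝ := ∫ y in (0 : ℝ)..1, g (s + s * y)

theorem intervalIntegrable_average {g : ℝ → ℝ} (hg : Monotone g) {s : ℝ} (hs : 0 ≤ s) :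
    IntervalIntegrable (fun y => g (s + s * y)) volume 0 1 := by
  refine Monotone.intervalIntegrable fun x y hxy => hg ?_
  have := mul_le_mul_of_nonneg_left hxy hs
  linarith

theorem le_average {g : ℝ → ℝ} (hg : Monotone g) {s : ℝ} (hs : 0 ≤ s) : g s ≤ average g s := by
  have h := intervalIntegral.integral_mono_on (μ := volume) (f := fun _ => g s) zero_le_one
    intervalIntegrable_const (intervalIntegrable_average hg hs) fun y hy => hg (by
      have := mul_nonneg hs hy.1
      linarith)
  simpa [average] using h

theorem average_le {g : ℝ → ℝ} (hg : Monotone g) {s : ℝ} (hs : 0 ≤ s) :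
    average g s ≤ g (2 * s) := by
  have h := intervalIntegral.integral_mono_on (μ := volume) (g := fun _ => g (2 * s)) zero_le_one
    (intervalIntegrable_average hg hs) intervalIntegrable_const fun y hy => hg (by
      have := mul_le_mul_of_nonneg_left hy.2 hs
      linarith)
  simpa [average] using h

theorem average_mono {g : ℝ → ℝ} (hg : Monotone g) {s t : ℝ} (hs : 0 ≤ s) (hst : s ≤ t) :
    average g s ≤ average g t :=
  intervalIntegral.integral_mono_on zero_le_one (intervalIntegrable_average hg hs)
    (intervalIntegrable_average hg (hs.trans hst)) fun y hy => hg (by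
      have := mul_le_mul_of_nonneg_right hst hy.1
      linarith)

theorem continuousAt_average {g : ℝ → ℝ} (hg : Monotone g) {s : ℝ} (hs : 0 < s) :
    ContinuousAt (average g) s := by
  have hP : Continuous fun b => ∫ x in (0 : ℝ)..b, g x :=
    intervalIntegral.continuous_primitive (fun _ _ => hg.intervalIntegrable) 0
  have key : ∀ t : ℝ, 0 < t →
      t⁻¹ * ((∫ x in (0 : ℝ)..(2 * t), g x) - ∫ x in (0 : ℝ)..t, g x) = average g t := by
    intro t ht
    rw [average, intervalIntegral.integral_comp_add_mul _ ht.ne',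
      intervalIntegral.integral_interval_sub_left hg.intervalIntegrable hg.intervalIntegrable,
      smul_eq_mul]
    ring_nf
  have hc : ContinuousAt (fun t : ℝ =>
      t⁻¹ * ((∫ x in (0 : ℝ)..(2 * t), g x) - ∫ x in (0 : ℝ)..t, g x)) s :=
    (continuousAt_inv₀ hs.ne').mul
      ((hP.comp (continuous_const.mul continuous_id)).sub hP).continuousAt
  exact hc.congr ((eventually_gt_nhds hs).mono key)

theorem classN_average {g : ℝ → ℝ} (hg : Monotone g) (hg0 : Tendsto g (𝓝[≥] 0) (𝓝 0)) :
    ClassN (average g) := by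
  have hz : g 0 = 0 := tendsto_nhds_unique (tendsto_pure_nhds g 0)
    (hg0.mono_left (pure_le_nhdsWithin Set.self_mem_Ici))
  have h0 : average g 0 = 0 := by simp [average, hz]
  refine ⟨fun s hs => ?_, h0, fun s hs t _ hst => average_mono hg hs hst⟩
  rcases (Set.mem_Ici.mp hs).eq_or_lt with rfl | hpos
  · rw [ContinuousWithinAt, h0]
    have h2 : Tendsto (fun s : ℝ => g (2 * s)) (𝓝[≥] 0) (𝓝 0) := by
      refine hg0.comp (tendsto_nhdsWithin_iff.mpr ⟨?_, ?_⟩)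
      · exact ((continuous_const_mul (2 : ℝ)).tendsto' 0 0 (mul_zero _)).mono_left
          nhdsWithin_le_nhds
      · filter_upwards [self_mem_nhdsWithin] with s hs
        exact mul_nonneg zero_le_two (Set.mem_Ici.mp hs)
    refine tendsto_of_tendsto_of_tendsto_of_le_of_le' hg0 h2 ?_ ?_
    · filter_upwards [self_mem_nhdsWithin] with s hs using le_average hg hs
    · filter_upwards [self_mem_nhdsWithin] with s hs using average_le hg hs
  · exact (continuousAt_average hg hpos).continuousWithinAt

/-- If `q i` is bounded in terms of `p i`, and small when `p i` is small, then `q i` is bounded by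
a class `N` function of `p i`. -/
theorem exists_classN {ι : Type*} (p q : ι → ℝ)
    (hsmall : ∀ ε, 0 < ε → ∃ δ, 0 < δ ∧ ∀ i, p i ≤ δ → q i ≤ ε)
    (hbdd : ∀ M, ∃ B, ∀ i, p i ≤ M → q i ≤ B) :
    ∃ ω : ℝ → ℝ, ClassN ω ∧ ∀ i, 0 ≤ p i → q i ≤ ω (p i) := by
  let A : ℝ → Set ℝ := fun s => insert 0 {y | ∃ i, p i ≤ s ∧ q i = y}
  have hA : ∀ s, BddAbove (A s) := by
    intro s
    obtain ⟨B, hB⟩ := hbdd s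
    refine BddAbove.insert 0 ⟨B, ?_⟩
    rintro _ ⟨i, hi, rfl⟩
    exact hB i hi
  have hne : ∀ s, (A s).Nonempty := fun s => ⟨0, Set.mem_insert _ _⟩
  have hmono : Monotone fun s => sSup (A s) := fun s t hst =>
    csSup_le_csSup (hA t) (hne s) (Set.insert_subset_insert fun y ⟨i, hi, hy⟩ =>
      ⟨i, hi.trans hst, hy⟩)
  have hnn : ∀ s, 0 ≤ sSup (A s) := fun s => le_csSup (hA s) (Set.mem_insert _ _)
  have h0 : Tendsto (fun s => sSup (A s)) (𝓝[≥] 0) (𝓝 0) := by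
    refine tendsto_order.2 ⟨fun a ha => Eventually.of_forall fun s => ha.trans_le (hnn s),
      fun a ha => ?_⟩
    obtain ⟨δ, hδ, h⟩ := hsmall (a / 2) (half_pos ha)
    filter_upwards [nhdsWithin_le_nhds (eventually_le_nhds hδ)] with s hs
    refine (csSup_le (hne s) ?_).trans_lt (half_lt_self ha)
    rintro y (rfl | ⟨i, hi, rfl⟩)
    · exact (half_pos ha).le
    · exact h i (hi.trans hs)
  exact ⟨_, classN_average hmono h0, fun i hi =>
    (le_csSup (hA (p i)) (Set.mem_insert_of_mem _ ⟨i, le_rfl, rfl⟩)).trans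
      (le_average hmono hi)⟩

/-- A class `K∞` function has a left inverse up to an inequality which is of class `N`. -/
theorem ClassKInf.exists_inverse {a : ℝ → ℝ} (ha : ClassKInf a) :
    ∃ ψ : ℝ → ℝ, ClassN ψ ∧ ∀ s, 0 ≤ s → s ≤ ψ (a s) := by
  have hle : ∀ {s t : ℝ}, 0 ≤ s → 0 ≤ t → a s ≤ a t → s ≤ t := fun hs ht =>
    (ha.strictMonoOn.le_iff_le hs ht).mp
  obtain ⟨ψ, hψ, h⟩ := exists_classN (fun s : Set.Ici (0 : ℝ) => a s) (fun s => (s : ℝ))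
    (fun ε hε => ⟨a ε, ha.toClassK.pos hε, fun s => hle s.2 hε.le⟩)
    (fun M => by
      obtain ⟨B, hB, hB0⟩ := ((ha.tendsto_atTop.eventually_gt_atTop M).and
        (eventually_ge_atTop 0)).exists
      exact ⟨B, fun s hs => hle s.2 hB0 (hs.trans hB.le)⟩)
  exact ⟨ψ, hψ, fun s hs => h ⟨s, hs⟩ (ha.classN.nonneg hs)⟩

/-- A family of triples (size `s`, time `t`, value `y`) for which `y` is bounded in terms of `s`,
small when `s` is small, and small for large `t` uniformly in `s ≤ M`, lies under the graph of a
class `KL` function. The function is obtained from the supremum of the values by averaging in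
both variables, and adding `s e⁻ᵗ` for strict monotonicity. -/
theorem exists_classKL (Q : ℝ → ℝ → ℝ → Prop)
    (hbdd : ∀ M, ∃ B, ∀ s t y, Q s t y → s ≤ M → y ≤ B)
    (hsmall : ∀ ε, 0 < ε → ∃ δ, 0 < δ ∧ ∀ s t y, Q s t y → s ≤ δ → y ≤ ε)
    (hlim : ∀ M ε, 0 < ε → ∃ T, ∀ s t y, Q s t y → s ≤ M → T ≤ t → y ≤ ε) :
    ∃ β : ℝ → ℝ → ℝ, ClassKL β ∧ ∀ s t y, Q s t y → 0 ≤ s → y ≤ β s t := by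
  let A : ℝ → ℝ → Set ℝ := fun s t => insert 0 {y | ∃ s' t', Q s' t' y ∧ s' ≤ s ∧ t ≤ t'}
  let b : ℝ → ℝ → ℝ := fun s t => sSup (A s t)
  have hA : ∀ s t, BddAbove (A s t) := by
    intro s t
    obtain ⟨B, hB⟩ := hbdd s
    refine BddAbove.insert 0 ⟨B, ?_⟩
    rintro y ⟨s', t', hQ, hs, -⟩
    exact hB s' t' y hQ hs
  have hne : ∀ s t, (A s t).Nonempty := fun s t => ⟨0, Set.mem_insert _ _⟩
  have hmono : ∀ t, Monotone fun s => b s t := fun t s₁ s₂ h =>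
    csSup_le_csSup (hA s₂ t) (hne s₁ t) (Set.insert_subset_insert
      fun y ⟨s', t', hQ, hs, ht⟩ => ⟨s', t', hQ, hs.trans h, ht⟩)
  have hanti : ∀ s, Antitone (b s) := fun s t₁ t₂ h =>
    csSup_le_csSup (hA s t₁) (hne s t₂) (Set.insert_subset_insert
      fun y ⟨s', t', hQ, hs, ht⟩ => ⟨s', t', hQ, hs, h.trans ht⟩)
  have hnn : ∀ s t, 0 ≤ b s t := fun s t => le_csSup (hA s t) (Set.mem_insert _ _)
  have hle : ∀ {s t c}, 0 ≤ c → (∀ s' t' y, Q s' t' y → s' ≤ s → t ≤ t' → y ≤ c) → b s t ≤ c := by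
    intro s t c hc h
    refine csSup_le (hne s t) ?_
    rintro y (rfl | ⟨s', t', hQ, hs, ht⟩)
    · exact hc
    · exact h s' t' y hQ hs ht
  have hint : ∀ s t₁ t₂, IntervalIntegrable (b s) volume t₁ t₂ := fun s _ _ =>
    (hanti s).intervalIntegrable
  -- Averaging in time over `[t - 1, t]` makes the bound continuous in `t`.
  let b₁ : ℝ → ℝ → ℝ := fun s t => ∫ y in (0 : ℝ)..1, b s (t - y)
  have hcomp : ∀ s t, IntervalIntegrable (fun y => b s (t - y)) volume 0 1 := fun s t =>
    Monotone.intervalIntegrable fun x y hxy => hanti s (by linarith)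
  have hb₁_mono : ∀ t, Monotone fun s => b₁ s t := fun t s₁ s₂ h =>
    intervalIntegral.integral_mono_on zero_le_one (hcomp s₁ t) (hcomp s₂ t) fun y _ =>
      hmono _ h
  have hb₁_anti : ∀ s, Antitone (b₁ s) := fun s t₁ t₂ h =>
    intervalIntegral.integral_mono_on zero_le_one (hcomp s t₂) (hcomp s t₁) fun y _ =>
      hanti s (by linarith)
  have hb₁_ge : ∀ s t, b s t ≤ b₁ s t := fun s t => by
    have h := intervalIntegral.integral_mono_on (μ := volume) (f := fun _ => b s t) zero_le_one
      intervalIntegrable_const (hcomp s t) fun y hy => hanti s (by linarith [hy.1])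
    rwa [intervalIntegral.integral_const, sub_zero, one_smul] at h
  have hb₁_le : ∀ s t, b₁ s t ≤ b s (t - 1) := fun s t => by
    have h := intervalIntegral.integral_mono_on (μ := volume) (g := fun _ => b s (t - 1))
      zero_le_one (hcomp s t) intervalIntegrable_const fun y hy => hanti s (by linarith [hy.2])
    rwa [intervalIntegral.integral_const, sub_zero, one_smul] at h
  have hb₁_cont : ∀ s, Continuous (b₁ s) := fun s => by
    have hP : Continuous fun t => ∫ y in (0 : ℝ)..t, b s y :=
      intervalIntegral.continuous_primitive (hint s) 0
    have : b₁ s = fun t => (∫ y in (0 : ℝ)..t, b s y) - ∫ y in (0 : ℝ)..(t - 1), b s y := by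
      funext t
      rw [intervalIntegral.integral_interval_sub_left (hint s _ _) (hint s _ _)]
      simp only [b₁]
      rw [intervalIntegral.integral_comp_sub_left, sub_zero]
    rw [this]
    exact hP.sub (hP.comp (continuous_id.sub continuous_const))
  have hb₁_nn : ∀ s t, 0 ≤ b₁ s t := fun s t => (hnn s t).trans (hb₁_ge s t)
  have hb₁_zero : ∀ t, Tendsto (fun s => b₁ s t) (𝓝[≥] 0) (𝓝 0) := by
    intro t
    refine tendsto_order.2 ⟨fun a ha => Eventually.of_forall fun s => ha.trans_le (hb₁_nn s t),
      fun a ha => ?_⟩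
    obtain ⟨δ, hδ, h⟩ := hsmall (a / 2) (half_pos ha)
    filter_upwards [nhdsWithin_le_nhds (eventually_le_nhds hδ)] with s hs
    exact ((hb₁_le s t).trans (hle (half_pos ha).le fun s' t' y hQ hs' _ =>
      h s' t' y hQ (hs'.trans hs))).trans_lt (half_lt_self ha)
  have hav : ∀ t, ClassN (average fun s => b₁ s t) := fun t =>
    classN_average (hb₁_mono t) (hb₁_zero t)
  have hav_anti : ∀ s, 0 ≤ s → Antitone fun t => average (fun s => b₁ s t) s :=
    fun s hs t₁ t₂ h => intervalIntegral.integral_mono_on zero_le_one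
      (intervalIntegrable_average (hb₁_mono t₂) hs) (intervalIntegrable_average (hb₁_mono t₁) hs)
      fun y _ => hb₁_anti _ h
  have hav_cont : ∀ s, 0 ≤ s → Continuous fun t => average (fun s => b₁ s t) s := by
    intro s hs
    obtain ⟨B, hB⟩ := hbdd (2 * s)
    refine intervalIntegral.continuous_of_dominated_interval (bound := fun _ => max B 0)
      (fun t => ?_) (fun t => Eventually.of_forall fun y hy => ?_) intervalIntegrable_const
      (Eventually.of_forall fun y _ => hb₁_cont _)
    · rw [Set.uIoc_of_le zero_le_one]
      exact (intervalIntegrable_average (hb₁_mono t) hs).1.aestronglyMeasurable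
    · rw [Set.uIoc_of_le zero_le_one] at hy
      rw [Real.norm_of_nonneg (hb₁_nn _ _)]
      refine (hb₁_le _ _).trans (hle (le_max_right _ _) fun s' t' z hQ hs' _ =>
        (hB s' t' z hQ (hs'.trans ?_)).trans (le_max_left _ _))
      have := mul_le_mul_of_nonneg_left hy.2 hs
      linarith
  have hav_lim : ∀ s, 0 ≤ s → Tendsto (fun t => average (fun s => b₁ s t) s) atTop (𝓝 0) := by
    intro s hs
    refine tendsto_order.2 ⟨fun a ha => Eventually.of_forall fun t =>
      ha.trans_le ((hav t).nonneg hs), fun a ha => ?_⟩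
    obtain ⟨T, hT⟩ := hlim (2 * s) (a / 2) (half_pos ha)
    filter_upwards [eventually_ge_atTop (T + 1)] with t ht
    refine ((average_le (hb₁_mono t) hs).trans ((hb₁_le _ _).trans (hle (half_pos ha).le
      fun s' t' y hQ hs' ht' => hT s' t' y hQ hs' ?_))).trans_lt (half_lt_self ha)
    linarith
  refine ⟨fun s t => average (fun s => b₁ s t) s + s * Real.exp (-t), ⟨fun t _ => ?_,
    fun s hs => ?_⟩, fun s t y hQ hs => ?_⟩
  · refine ⟨(hav t).continuousOn.add (by fun_prop), by simp [(hav t).map_zero], ?_⟩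
    intro s₁ hs₁ s₂ hs₂ h
    exact add_lt_add_of_le_of_lt ((hav t).monotoneOn hs₁ hs₂ h.le)
      (mul_lt_mul_of_pos_right h (Real.exp_pos _))
  · refine ⟨fun t _ => add_nonneg ((hav t).nonneg hs) (mul_nonneg hs (Real.exp_pos _).le),
      ((hav_cont s hs).add (by fun_prop)).continuousOn, ?_, ?_⟩
    · intro t₁ _ t₂ _ h
      exact add_le_add (hav_anti s hs h)
        (mul_le_mul_of_nonneg_left (Real.exp_le_exp.mpr (neg_le_neg h)) hs)
    · simpa using (hav_lim s hs).add
        ((Real.tendsto_exp_neg_atTop_nhds_zero).const_mul s)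
  · refine le_trans ?_ (le_add_of_nonneg_right (mul_nonneg hs (Real.exp_pos _).le))
    exact (le_csSup (hA s t) (Set.mem_insert_of_mem _ ⟨s, t, hQ, le_rfl, le_rfl⟩)).trans
      ((hb₁_ge s t).trans (le_average (hb₁_mono t) hs))

/-! ### Upper right Dini derivatives -/

/-- A continuous function whose upper right Dini derivative is at most `g` almost everywhere and
bounded above *everywhere* grows at most by the integral of `g`. The everywhere bound cannot be
dropped (Cantor function). The exceptional null set is covered by an open set `U` of small
measure, and a large multiple of the measure of `U ∩ [a, t]` is subtracted from `w`. -/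
theorem sub_le_integral_of_dini {w g : ℝ → ℝ} {a b K : ℝ} {Z : Set ℝ} (hab : a ≤ b)
    (hw : ContinuousOn w (Set.Icc a b)) (hg : Continuous g) (hZ : volume Z = 0)
    (hK : ∀ t ∈ Set.Ico a b, ∀ᶠ z in 𝓝[>] t, w z - w t ≤ K * (z - t))
    (hae : ∀ t ∈ Set.Ico a b, t ∉ Z → ∀ ε, 0 < ε →
      ∀ᶠ z in 𝓝[>] t, w z - w t ≤ (g t + ε) * (z - t)) :
    w b - w a ≤ ∫ t in a..b, g t := by
  obtain ⟨c, hc⟩ := isCompact_Icc.exists_bound_of_continuousOn (s := Set.Icc a b)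
    hg.continuousOn
  have hc0 : 0 ≤ c := (norm_nonneg _).trans (hc a ⟨le_rfl, hab⟩)
  set C : ℝ := |K| + c with hC
  have hC0 : 0 ≤ C := by positivity
  refine le_of_forall_pos_le_add fun η hη => ?_
  have hε : 0 < η / (C + 1) := by positivity
  obtain ⟨U, hZU, hUo, hU⟩ := Z.exists_isOpen_lt_of_lt (μ := volume)
    (ENNReal.ofReal (η / (C + 1))) (by rw [hZ]; exact ENNReal.ofReal_pos.mpr hε)
  let m : ℝ → ℝ := fun t => ∫ s in a..t, U.indicator (fun _ => (1 : ℝ)) s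
  have hint : ∀ s t, IntervalIntegrable (U.indicator fun _ => (1 : ℝ)) volume s t := fun s t =>
    ⟨(integrableOn_const (by simp)).indicator hUo.measurableSet,
      (integrableOn_const (by simp)).indicator hUo.measurableSet⟩
  have hm : Continuous m := intervalIntegral.continuous_primitive hint a
  have hm_sub : ∀ s t, m t - m s = ∫ r in s..t, U.indicator (fun _ => (1 : ℝ)) r := fun s t =>
    intervalIntegral.integral_interval_sub_left (hint _ _) (hint _ _)
  have hm_mono : ∀ {s t}, s ≤ t → 0 ≤ m t - m s := fun {s t} hst => by
    rw [hm_sub]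
    exact intervalIntegral.integral_nonneg hst fun r _ =>
      Set.indicator_nonneg (fun _ _ => zero_le_one) r
  have hm_U : ∀ t ∈ U, ∀ᶠ z in 𝓝[>] t, m z - m t = z - t := by
    intro t ht
    obtain ⟨u, htu, hu⟩ := mem_nhdsGE_iff_exists_Icc_subset.mp
      (mem_nhdsWithin_of_mem_nhds (hUo.mem_nhds ht))
    filter_upwards [Ioo_mem_nhdsGT htu] with z hz
    rw [hm_sub, intervalIntegral.integral_congr (g := fun _ => (1 : ℝ))]
    · simp
    · intro r hr
      rw [Set.uIcc_of_le hz.1.le] at hr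
      exact Set.indicator_of_mem (hu ⟨hr.1, hr.2.trans hz.2.le⟩) _
  have hm_b : m b ≤ η / (C + 1) := by
    simp only [m]
    rw [intervalIntegral.integral_of_le hab, integral_indicator_const _ hUo.measurableSet,
      smul_eq_mul, mul_one]
    refine (ENNReal.toReal_mono ENNReal.ofReal_ne_top
      ((Measure.restrict_apply_le _ _).trans hU.le)).trans ?_
    rw [ENNReal.toReal_ofReal hε.le]
  have key := image_le_of_liminf_slope_right_le_deriv_boundary
    (f := fun t => w t - C * m t) (a := a) (b := b)
    (B := fun t => w a + ∫ s in a..t, g s) (B' := g)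
    (hw.sub (hm.const_mul C).continuousOn) (by simp [m])
    (continuous_const.add (intervalIntegral.continuous_primitive
      (fun _ _ => hg.intervalIntegrable _ _) a)).continuousOn
    (fun t _ => ((intervalIntegral.integral_hasDerivAt_right (hg.intervalIntegrable _ _)
      (hg.stronglyMeasurableAtFilter _ _) hg.continuousAt).const_add _).hasDerivWithinAt)
    (fun t ht r hr => Eventually.frequently ?_) (x := b) ⟨hab, le_rfl⟩
  · have : C * m b ≤ η := calc
      C * m b ≤ C * (η / (C + 1)) := mul_le_mul_of_nonneg_left hm_b hC0
      _ ≤ (C + 1) * (η / (C + 1)) := mul_le_mul_of_nonneg_right (by linarith) hε.le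
      _ = η := by field_simp
    linarith
  · by_cases hZt : t ∈ Z
    · filter_upwards [hK t ht, hm_U t (hZU hZt), self_mem_nhdsWithin] with z hz hmz hzt
      have hzt' : 0 < z - t := sub_pos.mpr hzt
      rw [slope_def_field, div_lt_iff₀ hzt']
      have h1 : K - C ≤ g t := by
        have := hc t (Set.Ico_subset_Icc_self ht)
        rw [Real.norm_eq_abs] at this
        linarith [neg_abs_le (g t), le_abs_self K]
      have h2 : (K - C) * (z - t) < r * (z - t) :=
        mul_lt_mul_of_pos_right (h1.trans_lt hr) hzt'
      have h3 : C * m z - C * m t = C * (z - t) := by rw [← mul_sub, hmz]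
      linarith
    · filter_upwards [hae t ht hZt ((r - g t) / 2) (by linarith), self_mem_nhdsWithin]
        with z hz hzt
      have hzt' : 0 < z - t := sub_pos.mpr hzt
      rw [slope_def_field, div_lt_iff₀ hzt']
      have h1 : 0 ≤ C * m z - C * m t := by
        rw [← mul_sub]
        exact mul_nonneg hC0 (hm_mono (le_of_lt hzt))
      have h2 : (g t + (r - g t) / 2) * (z - t) < r * (z - t) :=
        mul_lt_mul_of_pos_right (by linarith) hzt'
      linarith

/-! ### History segments -/

section Segments

variable {Δ : ℝ≥0} {n m : ℕ}

theorem segment_apply_of_continuous {x : ℝ → Vec n} (hx : Continuous x) (t : ℝ)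
    (τ : Set.Icc (-(Δ : ℝ)) 0) : segment Δ x t τ = x (t + τ) :=
  segment_apply hx.continuousOn τ

theorem current_segment {x : ℝ → Vec n} (hx : Continuous x) (t : ℝ) :
    current (segment Δ x t) = x t := by
  rw [current, segment_apply_of_continuous hx, add_zero]

theorem value_segment {x : ℝ → Vec n} (hx : Continuous x) (t : ℝ) {τ : ℝ}
    (hτ : τ ∈ Set.Icc (-(Δ : ℝ)) 0) : value (segment Δ x t) τ = x (t + τ) := by
  rw [value_of_mem _ hτ, segment_apply_of_continuous hx]

theorem continuous_segment {x : ℝ → Vec n} (hx : Continuous x) : Continuous (segment Δ x) := by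
  let G : C(ℝ × Set.Icc (-(Δ : ℝ)) 0, Vec n) := ⟨fun p => x (p.1 + p.2), by fun_prop⟩
  have : segment Δ x = G.curry := by
    funext t
    ext1 τ
    exact segment_apply_of_continuous hx t τ
  rw [this]
  exact G.curry.continuous

theorem segment_congr {x y : ℝ → Vec n} {t : ℝ}
    (h : ∀ s ∈ Set.Icc (t - Δ) t, x s = y s) : segment Δ x t = segment Δ y t := by
  have : (fun τ : Set.Icc (-(Δ : ℝ)) 0 => x (t + τ)) =
      fun τ : Set.Icc (-(Δ : ℝ)) 0 => y (t + τ) := by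
    funext τ
    exact h _ ⟨by linarith [τ.2.1], by linarith [τ.2.2]⟩
  by_cases hc : Continuous fun τ : Set.Icc (-(Δ : ℝ)) 0 => x (t + τ)
  · rw [segment, segment, dif_pos hc, dif_pos (this ▸ hc)]
    ext1 τ
    exact congrFun this τ
  · rw [segment, segment, dif_neg hc, dif_neg (this ▸ hc)]

theorem norm_segment_le {x : ℝ → Vec n} (hx : Continuous x) {t C : ℝ} (hC : 0 ≤ C)
    (h : ∀ s ∈ Set.Icc (t - Δ) t, ‖x s‖ ≤ C) : ‖segment Δ x t‖ ≤ C := by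
  refine (ContinuousMap.norm_le _ hC).mpr fun τ => ?_
  rw [segment_apply_of_continuous hx]
  exact h _ ⟨by linarith [τ.2.1], by linarith [τ.2.2]⟩

theorem norm_value_le (φ : History Δ n) (τ : ℝ) : ‖value φ τ‖ ≤ ‖φ‖ := φ.norm_coe_le_norm _

theorem norm_shift_le (φ : History Δ n) (w : Vec n) {h : ℝ} (hh : 0 ≤ h) :
    ‖shift φ w h‖ ≤ ‖φ‖ + h * ‖w‖ := by
  refine (ContinuousMap.norm_le _ (by positivity)).mpr fun τ => ?_
  refine (norm_add_le _ _).trans (add_le_add (norm_value_le _ _) ?_)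
  rw [norm_smul, Real.norm_of_nonneg (le_max_right _ _)]
  exact mul_le_mul_of_nonneg_right (max_le (by linarith [τ.2.2]) hh) (norm_nonneg _)

/-- The segment at time `t + h` differs from the shifted segment at time `t` only on `[-h, 0]`, by
the error of the linear approximation of `x` at `t`. -/
theorem norm_segment_sub_shift_le {x : ℝ → Vec n} (hx : Continuous x) (w : Vec n) {t h C : ℝ}
    (hh : 0 ≤ h) (hC : 0 ≤ C)
    (hxC : ∀ s ∈ Set.Icc 0 h, ‖x (t + s) - x t - s • w‖ ≤ C) :
    ‖segment Δ x (t + h) - shift (segment Δ x t) w h‖ ≤ C := by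
  refine (ContinuousMap.norm_le _ hC).mpr fun τ => ?_
  rw [ContinuousMap.sub_apply, segment_apply_of_continuous hx]
  rcases lt_or_ge (τ : ℝ) (-h) with hτ | hτ
  · rw [shift_of_lt _ _ hh τ hτ, segment_apply_of_continuous hx, add_assoc, add_comm h, sub_self,
      norm_zero]
    exact hC
  · rw [shift_of_le _ _ τ hτ, current_segment hx, ← sub_sub, add_assoc]
    exact hxC _ ⟨by linarith, by linarith [τ.2.2]⟩

theorem continuous_comp_norm {a : ℝ → ℝ} (ha : ClassN a) {x : ℝ → Vec n} (hx : Continuous x) :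
    Continuous fun t => a ‖x t‖ :=
  ha.continuousOn.comp_continuous hx.norm fun _ => norm_nonneg _

theorem LipschitzOnBounded.continuous {V : History Δ n → ℝ} (hV : LipschitzOnBounded V) :
    Continuous V := by
  refine continuous_iff_continuousAt.mpr fun φ => ?_
  obtain ⟨L, hL, h⟩ := hV (‖φ‖ + 1) (by positivity)
  have hnear : ∀ᶠ ψ in 𝓝 φ, ‖ψ‖ ≤ ‖φ‖ + 1 :=
    continuous_norm.continuousAt.eventually (eventually_le_nhds (lt_add_one _))
  rw [ContinuousAt, tendsto_iff_norm_sub_tendsto_zero]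
  have hlim : Tendsto (fun ψ => L * ‖ψ - φ‖) (𝓝 φ) (𝓝 0) :=
    Continuous.tendsto' (by fun_prop) _ _ (by simp)
  exact squeeze_zero' (Eventually.of_forall fun _ => norm_nonneg _)
    (hnear.mono fun ψ hψ => h ψ φ hψ (by linarith)) hlim

theorem FieldLipschitzOnBounded.continuous {f : History Δ n → Vec m → Vec n}
    (hf : FieldLipschitzOnBounded f) : Continuous fun p : History Δ n × Vec m => f p.1 p.2 := by
  refine continuous_iff_continuousAt.mpr fun p => ?_
  obtain ⟨L, hL, h⟩ := hf (‖p‖ + 1) (by positivity)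
  have hnear : ∀ᶠ q in 𝓝 p, ‖q‖ ≤ ‖p‖ + 1 :=
    continuous_norm.continuousAt.eventually (eventually_le_nhds (lt_add_one _))
  rw [ContinuousAt, tendsto_iff_norm_sub_tendsto_zero]
  have hlim : Tendsto (fun q : History Δ n × Vec m => L * (‖q.1 - p.1‖ + ‖q.2 - p.2‖)) (𝓝 p)
      (𝓝 0) := Continuous.tendsto' (by fun_prop) _ _ (by simp)
  refine squeeze_zero' (Eventually.of_forall fun _ => norm_nonneg _)
    (hnear.mono fun q hq => h _ _ _ _ ((norm_fst_le q).trans hq) ?_ ((norm_snd_le q).trans hq) ?_)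
    hlim
  · linarith [norm_fst_le p]
  · linarith [norm_snd_le p]

/-! ### Dissipation along solutions -/

/-- Driver's derivative controls the forward increments of `V` along a curve which is
approximated by its tangent `w` up to a relative error `e`. -/
theorem eventually_sub_le_of_driverDeriv_le {V : History Δ n → ℝ} {x : ℝ → Vec n}
    (hx : Continuous x) {t c e ε R L : ℝ} {w : Vec n} (he : 0 ≤ e) (hε : 0 < ε) (hL0 : 0 < L)
    (hL : ∀ φ₁ φ₂ : History Δ n, ‖φ₁‖ ≤ R → ‖φ₂‖ ≤ R → |V φ₁ - V φ₂| ≤ L * ‖φ₁ - φ₂‖)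
    (hR : ‖segment Δ x t‖ + 1 ≤ R) (hD : driverDeriv V (segment Δ x t) w ≤ (c : EReal))
    (hw : ∀ᶠ z in 𝓝[>] t, ‖x z - x t - (z - t) • w‖ ≤ e * (z - t)) :
    ∀ᶠ z in 𝓝[>] t, V (segment Δ x z) - V (segment Δ x t) ≤ (c + ε + L * e) * (z - t) := by
  have hsub : Tendsto (fun z : ℝ => z - t) (𝓝[>] t) (𝓝[>] 0) := by
    refine tendsto_nhdsWithin_iff.mpr ⟨?_, ?_⟩
    · exact ((continuous_id.sub continuous_const).tendsto' t 0 (sub_self t)).mono_left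
        nhdsWithin_le_nhds
    · filter_upwards [self_mem_nhdsWithin] with z hz using sub_pos.mpr (Set.mem_Ioi.mp hz)
  have hDε : ∀ᶠ h in 𝓝[>] (0 : ℝ),
      (V (shift (segment Δ x t) w h) - V (segment Δ x t)) / h < c + ε := by
    have hlt : driverDeriv V (segment Δ x t) w < ((c + ε : ℝ) : EReal) :=
      hD.trans_lt (EReal.coe_lt_coe_iff.mpr (by linarith))
    exact (eventually_lt_of_limsup_lt hlt).mono fun h hh => EReal.coe_lt_coe_iff.mp hh
  have hseg : ∀ᶠ z in 𝓝[>] t, ‖segment Δ x z‖ ≤ ‖segment Δ x t‖ + 1 :=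
    nhdsWithin_le_nhds ((continuous_segment hx).norm.continuousAt.eventually
      (eventually_le_nhds (lt_add_one _)))
  have hsh : ∀ᶠ h in 𝓝[>] (0 : ℝ), h * ‖w‖ ≤ 1 := nhdsWithin_le_nhds
    ((Continuous.tendsto' (f := fun h : ℝ => h * ‖w‖) (by fun_prop) 0 0 (zero_mul _)).eventually
      (eventually_le_nhds one_pos))
  obtain ⟨u, htu, hu⟩ := mem_nhdsGT_iff_exists_Ioo_subset.mp hw
  filter_upwards [hsub.eventually hDε, hseg, hsub.eventually hsh, Ioo_mem_nhdsGT htu]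
    with z hz1 hz2 hz3 hz
  have hpos : 0 < z - t := sub_pos.mpr hz.1
  rw [div_lt_iff₀ hpos] at hz1
  have hclose : ‖segment Δ x z - shift (segment Δ x t) w (z - t)‖ ≤ e * (z - t) := by
    have := norm_segment_sub_shift_le (Δ := Δ) hx w (t := t) (h := z - t) (C := e * (z - t))
      hpos.le (by positivity) fun s hs => ?_
    · rwa [add_sub_cancel] at this
    · rcases hs.1.eq_or_lt with rfl | hs0
      · simpa using mul_nonneg he hpos.le
      · have hmem : ‖x (t + s) - x t - (t + s - t) • w‖ ≤ e * (t + s - t) :=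
          hu ⟨by linarith, by linarith [hs.2, hz.2]⟩
        rw [add_sub_cancel_left] at hmem
        exact hmem.trans (mul_le_mul_of_nonneg_left hs.2 he)
  have hV := (abs_le.mp (hL (segment Δ x z) (shift (segment Δ x t) w (z - t)) (hz2.trans hR)
    (((norm_shift_le _ _ hpos.le).trans (by linarith)).trans hR))).2
  have hmul := mul_le_mul_of_nonneg_left hclose hL0.le
  nlinarith

theorem FieldLipschitzOnBounded.exists_bound {f : History Δ n → Vec m → Vec n}
    (hf : FieldLipschitzOnBounded f) (hf0 : f 0 0 = 0) (r : ℝ) :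
    ∃ C, 0 ≤ C ∧ ∀ φ v, ‖φ‖ ≤ r → ‖v‖ ≤ r → ‖f φ v‖ ≤ C := by
  obtain ⟨L, hL, h⟩ := hf (|r| + 1) (by positivity)
  have hr := le_abs_self r
  refine ⟨L * (|r| + |r|), by positivity, fun φ v hφ hv => ?_⟩
  have := h φ 0 v 0 (by linarith) (by rw [norm_zero]; positivity) (by linarith)
    (by rw [norm_zero]; positivity)
  rw [hf0, sub_zero, sub_zero, sub_zero] at this
  exact this.trans (mul_le_mul_of_nonneg_left (by linarith) hL.le)

/-- The integrated dissipation inequality. At almost every time the solution is differentiable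
with derivative `f (x_t, u(t))`. At the remaining times a crude bound on the Dini derivative of
`V` suffices, which follows from the dissipation inequality for the input value `0`: both the
solution and the direction `f (x_t, 0)` have bounded speed. -/
theorem dissipation_of_integral_eq {f : History Δ n → Vec m → Vec n}
    (hf : FieldLipschitzOnBounded f) (hf0 : f 0 0 = 0) {V : History Δ n → ℝ}
    (hV : LipschitzOnBounded V) {α γ : ℝ → ℝ} (hα : ClassN α) (hγ : ClassN γ)
    (hdiss : ∀ (φ : History Δ n) (v : Vec m),
      driverDeriv V φ (f φ v) ≤ ((-α ‖current φ‖ + γ ‖v‖ : ℝ) : EReal))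
    {u : ℝ → Vec m} {x : ℝ → Vec n} (hx : Continuous x) {a b r : ℝ} (ha : 0 ≤ a) (hab : a ≤ b)
    (hr : 0 ≤ r) (hu : ∀ᵐ s, s ∈ Set.Icc 0 b → ‖u s‖ ≤ r)
    (hint : IntervalIntegrable (fun s => f (segment Δ x s) (u s)) volume 0 b)
    (heq : ∀ t ∈ Set.Icc 0 b, x t = x 0 + ∫ s in (0 : ℝ)..t, f (segment Δ x s) (u s)) :
    V (segment Δ x b) - V (segment Δ x a) ≤ ∫ t in a..b, (γ r - α ‖x t‖) := by
  have hb : 0 ≤ b := ha.trans hab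
  obtain ⟨R, hR⟩ := isCompact_Icc.exists_bound_of_continuousOn (s := Set.Icc 0 b)
    (continuous_segment (Δ := Δ) hx).continuousOn
  have hR0 : 0 ≤ R := (norm_nonneg _).trans (hR 0 ⟨le_rfl, hb⟩)
  obtain ⟨C, hC0, hC⟩ := hf.exists_bound hf0 (max R r)
  obtain ⟨L, hL0, hL⟩ := hV (R + 1) (by positivity)
  have hsub : ∀ t ∈ Set.Icc 0 b, ∀ z ∈ Set.Icc 0 b,
      x z - x t = ∫ s in t..z, f (segment Δ x s) (u s) := by
    intro t ht z hz
    rw [heq z hz, heq t ht, add_sub_add_left_eq_sub]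
    refine intervalIntegral.integral_interval_sub_left (hint.mono_set ?_) (hint.mono_set ?_)
    · rw [Set.uIcc_of_le hz.1, Set.uIcc_of_le hb]
      exact Set.Icc_subset_Icc_right hz.2
    · rw [Set.uIcc_of_le ht.1, Set.uIcc_of_le hb]
      exact Set.Icc_subset_Icc_right ht.2
  have hlip : ∀ t ∈ Set.Icc 0 b, ∀ z ∈ Set.Icc 0 b, t ≤ z → ‖x z - x t‖ ≤ C * (z - t) := by
    intro t ht z hz htz
    rw [hsub t ht z hz]
    refine (intervalIntegral.norm_integral_le_of_norm_le htz (g := fun _ => C) ?_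
      intervalIntegrable_const).trans_eq ?_
    · filter_upwards [hu] with s hs hst
      have hs0 : s ∈ Set.Icc 0 b := ⟨ht.1.trans hst.1.le, hst.2.trans hz.2⟩
      exact hC _ _ ((hR s hs0).trans (le_max_left _ _)) ((hs hs0).trans (le_max_right _ _))
    · rw [intervalIntegral.integral_const, smul_eq_mul, mul_comm]
  have hder := hint.ae_hasDerivAt_integral
  let Z : Set ℝ := {t | ¬((t ∈ Set.Icc 0 b → ‖u t‖ ≤ r) ∧ (t ∈ Set.uIcc 0 b → ∀ c ∈ Set.uIcc 0 b,
    HasDerivAt (fun z => ∫ s in c..z, f (segment Δ x s) (u s)) (f (segment Δ x t) (u t)) t))}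
  have hZ : volume Z = 0 := hu.and hder
  have hmem : ∀ t ∈ Set.Ico a b, t ∈ Set.Icc 0 b := fun t ht => ⟨ha.trans ht.1, ht.2.le⟩
  have hright : ∀ t ∈ Set.Ico a b, ∀ᶠ z in 𝓝[>] t, z ∈ Set.Icc 0 b ∧ t ≤ z := fun t ht => by
    filter_upwards [Ioo_mem_nhdsGT ht.2] with z hz
    exact ⟨⟨(hmem t ht).1.trans hz.1.le, hz.2.le⟩, hz.1.le⟩
  refine sub_le_integral_of_dini (w := fun t => V (segment Δ x t)) (K := γ 0 + 1 + L * (2 * C))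
    hab (hV.continuous.comp (continuous_segment hx)).continuousOn
    (continuous_const.sub (continuous_comp_norm hα hx)) hZ (fun t ht => ?_)
    fun t ht htZ ε hε => ?_
  -- The bound at every time: the tangent direction is taken to be `f (x_t, 0)`.
  · have hD : driverDeriv V (segment Δ x t) (f (segment Δ x t) 0) ≤ ((γ 0 : ℝ) : EReal) := by
      refine (hdiss _ _).trans (EReal.coe_le_coe_iff.mpr ?_)
      rw [norm_zero]
      linarith [hα.nonneg (norm_nonneg (current (segment Δ x t)))]
    refine eventually_sub_le_of_driverDeriv_le hx (by positivity) one_pos hL0 hL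
      (by linarith [hR t (hmem t ht)]) hD ?_
    filter_upwards [hright t ht] with z hz
    have h1 := hlip t (hmem t ht) z hz.1 hz.2
    have h2 : ‖f (segment Δ x t) 0‖ ≤ C := hC _ _ ((hR t (hmem t ht)).trans (le_max_left _ _))
      (by rw [norm_zero]; exact hr.trans (le_max_right _ _))
    have h3 : ‖(z - t) • f (segment Δ x t) 0‖ ≤ (z - t) * C := by
      rw [norm_smul, Real.norm_of_nonneg (sub_nonneg.mpr hz.2)]
      exact mul_le_mul_of_nonneg_left h2 (sub_nonneg.mpr hz.2)
    refine (norm_sub_le _ _).trans ?_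
    linarith
  -- The bound at almost every time: the tangent direction is the derivative of the solution.
  · have hgood : ‖u t‖ ≤ r ∧ HasDerivAt (fun z => ∫ s in (0 : ℝ)..z, f (segment Δ x s) (u s))
        (f (segment Δ x t) (u t)) t := by
      have h := not_not.mp htZ
      rw [Set.uIcc_of_le hb] at h
      exact ⟨h.1 (hmem t ht), h.2 (hmem t ht) 0 ⟨le_rfl, hb⟩⟩
    have hD : driverDeriv V (segment Δ x t) (f (segment Δ x t) (u t)) ≤
        ((γ r - α ‖x t‖ : ℝ) : EReal) := by
      refine (hdiss _ _).trans (EReal.coe_le_coe_iff.mpr ?_)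
      rw [current_segment hx]
      linarith [hγ.mono (norm_nonneg _) hgood.1]
    have hev := eventually_sub_le_of_driverDeriv_le (R := R + 1) (e := ε / (2 * L)) (ε := ε / 2) hx
      (by positivity) (half_pos hε) hL0 hL (by linarith [hR t (hmem t ht)]) hD ?_
    · have : ε / 2 + L * (ε / (2 * L)) = ε := by field_simp; norm_num
      simpa only [add_assoc, this] using hev
    · have hlo := nhdsWithin_le_nhds (s := Set.Ioi t)
        ((hasDerivAt_iff_isLittleO.mp hgood.2).def (c := ε / (2 * L)) (by positivity))
      filter_upwards [hlo, hright t ht] with z hz hzt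
      rw [Real.norm_of_nonneg (sub_nonneg.mpr hzt.2)] at hz
      rwa [heq z hzt.1, heq t (hmem t ht), add_sub_add_left_eq_sub]

end Segments

section Solutions

variable {Δ : ℝ≥0} {n m : ℕ}

theorem inputNorm_nonneg (u : ℝ → Vec m) (t : ℝ) : 0 ≤ inputNorm u t := ENNReal.toReal_nonneg

theorem IsInput.inputNorm_mono {u : ℝ → Vec m} (hu : IsInput u) {s t : ℝ} (hs : 0 ≤ s)
    (hst : s ≤ t) : inputNorm u s ≤ inputNorm u t :=
  ENNReal.toReal_mono (hu t (hs.trans hst)).eLpNorm_ne_top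
    (eLpNorm_mono_measure _ (Measure.restrict_mono (Set.Icc_subset_Icc_right hst) le_rfl))

theorem IsInput.ae_norm_le {u : ℝ → Vec m} (hu : IsInput u) {t : ℝ} (ht : 0 ≤ t) :
    ∀ᵐ s, s ∈ Set.Icc 0 t → ‖u s‖ ≤ inputNorm u t := by
  rw [← ae_restrict_iff' measurableSet_Icc]
  filter_upwards [ae_le_eLpNormEssSup (f := u) (μ := volume.restrict (Set.Icc 0 t))] with s hs
  rw [← eLpNorm_exponent_top] at hs
  have := ENNReal.toReal_mono (hu t ht).eLpNorm_ne_top hs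
  rwa [toReal_enorm] at this

/-- A solution on `[0, T)` coincides on `[-Δ, b]`, `b < T`, with a curve which is continuous on
the whole real line. -/
theorem IsSolution.exists_continuous {f : History Δ n → Vec m → Vec n} {φ : History Δ n}
    {u : ℝ → Vec m} {T : EReal} {x : ℝ → Vec n} (hx : IsSolution f φ u T x) {b : ℝ} (hb : 0 ≤ b)
    (hbT : (b : EReal) < T) :
    ∃ y : ℝ → Vec n, Continuous y ∧ (∀ s ∈ Set.Icc (-(Δ : ℝ)) b, y s = x s) ∧
      segment Δ y 0 = φ ∧
      IntervalIntegrable (fun s => f (segment Δ y s) (u s)) volume 0 b ∧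
      ∀ t ∈ Set.Icc 0 b, y t = y 0 + ∫ s in (0 : ℝ)..t, f (segment Δ y s) (u s) := by
  have hle : -(Δ : ℝ) ≤ b := (neg_delay_le Δ).trans hb
  have hcont : ContinuousOn x (Set.Icc (-(Δ : ℝ)) b) := hx.continuousOn.mono fun s hs =>
    ⟨hs.1, (EReal.coe_le_coe_iff.mpr hs.2).trans_lt hbT⟩
  let y : ℝ → Vec n := Set.IccExtend hle ((Set.Icc (-(Δ : ℝ)) b).domRestrict x)
  have hy : Continuous y := (continuousOn_iff_continuous_domRestrict.mp hcont).Icc_extend'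
  have hyx : ∀ s ∈ Set.Icc (-(Δ : ℝ)) b, y s = x s := fun s hs => by
    simp only [y]
    rw [Set.IccExtend_of_mem _ _ hs, Set.domRestrict_apply]
  have hseg : ∀ s ∈ Set.Icc 0 b, segment Δ y s = segment Δ x s := fun s hs =>
    segment_congr fun r hr => hyx r ⟨by linarith [hr.1, hs.1], hr.2.trans hs.2⟩
  have hy0 : segment Δ y 0 = φ := by
    ext1 τ
    rw [segment_apply_of_continuous hy, zero_add, hyx _ ⟨τ.2.1, τ.2.2.trans hb⟩, hx.initial]
  have hcongr : ∀ t ∈ Set.Icc 0 b, ∀ s ∈ Set.uIcc 0 t,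
      f (segment Δ x s) (u s) = f (segment Δ y s) (u s) := fun t ht s hs => by
    rw [Set.uIcc_of_le ht.1] at hs
    rw [hseg s ⟨hs.1, hs.2.trans ht.2⟩]
  refine ⟨y, hy, hyx, hy0, ?_, fun t ht => ?_⟩
  · exact (hx.integrable b hb hbT).congr fun s hs =>
      hcongr b ⟨hb, le_rfl⟩ s (Set.uIoc_subset_uIcc hs)
  · rw [hyx t ⟨(neg_delay_le Δ).trans ht.1, ht.2⟩, ← current_segment (Δ := Δ) hy 0, hy0,
      hx.integral_eq t ht.1 ((EReal.coe_le_coe_iff.mpr ht.2).trans_lt hbT),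
      intervalIntegral.integral_congr (hcongr t ht)]

end Solutions

/-! ### Decay over windows -/

section Window

variable {v σ : ℝ → ℝ} {G T b : ℝ}

/-- If `v` can grow at most at rate `G`, and `v t` is bounded by a function of the decrease of
`v` over the window `[t - T, t]`, then after `N` windows either `v` is below the level
`σ (2GT + ε) + G`, or it has decreased by at least `N (GT + ε)`. -/
theorem window_decay (hσ : ClassN σ) (hG : 0 ≤ G) (hT : 0 < T)
    (h1 : ∀ s t, 0 ≤ s → s ≤ t → t ≤ b → v t ≤ v s + G * (t - s))
    (h2 : ∀ t, T ≤ t → t ≤ b → v t ≤ σ (v (t - T) - v t + G * T) + G) {ε : ℝ} (hε : 0 ≤ ε)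
    (N : ℕ) : ∀ t, N * T ≤ t → t ≤ b →
      v t ≤ σ (2 * (G * T) + ε) + G ∨ v t ≤ v (t - N * T) - N * (G * T + ε) := by
  have hGT : 0 ≤ G * T := mul_nonneg hG hT.le
  induction N with
  | zero => intro t _ _; right; simp
  | succ N ih =>
    intro t ht htb
    push_cast at ht ⊢
    have hNT : 0 ≤ (N : ℝ) * T := by positivity
    by_cases hle : v t ≤ σ (2 * (G * T) + ε) + G
    · exact Or.inl hle
    right
    have hdec : v t < v (t - T) - (G * T + ε) := by
      by_contra hcon
      have hgrow := h1 (t - T) t (by linarith) (by linarith) htb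
      have := hσ.mono (s := v (t - T) - v t + G * T) (t := 2 * (G * T) + ε)
        (by linarith) (by linarith)
      linarith [h2 t (by linarith) htb]
    rcases ih (t - T) (by linarith) (by linarith) with h | h
    · linarith
    · rw [show t - (N + 1) * T = t - T - N * T by ring]
      linarith

/-- The decay over windows gives an overshoot bound and, for every `ε > 0`, a bound which does not
involve `v 0` and holds after a time of order `v 0 / ε`. The term `G (T + 1)` accounts for the
growth over less than one window, and the level `σ (2GT + ε)` is split by the weak triangle
inequality. -/
theorem window_bound (hσ : ClassN σ) (hG : 0 ≤ G) (hT : 0 < T) (hv : ∀ t, 0 ≤ v t)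
    (h1 : ∀ s t, 0 ≤ s → s ≤ t → t ≤ b → v t ≤ v s + G * (t - s))
    (h2 : ∀ t, T ≤ t → t ≤ b → v t ≤ σ (v (t - T) - v t + G * T) + G) {t : ℝ} (ht : 0 ≤ t)
    (htb : t ≤ b) :
    v t ≤ v 0 + (G * (T + 1) + σ (4 * (G * T))) ∧
      ∀ ε, 0 < ε → T * (v 0 / ε + 1) ≤ t → v t ≤ σ (2 * ε) + (G * (T + 1) + σ (4 * (G * T))) := by
  have hGT : 0 ≤ G * T := mul_nonneg hG hT.le
  -- Going back `N` full windows from time `t` leads to a time in `[0, T)`.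
  set N := ⌊t / T⌋₊
  have hNle : N * T ≤ t := (le_div_iff₀ hT).mp (Nat.floor_le (by positivity))
  have hNlt : t < (N + 1) * T := (div_lt_iff₀ hT).mp (Nat.lt_floor_add_one _)
  have hstart : v (t - N * T) ≤ v 0 + G * T := by
    have h := h1 0 (t - N * T) le_rfl (by linarith) (by
      have : 0 ≤ (N : ℝ) * T := by positivity
      linarith)
    have : G * (t - N * T - 0) ≤ G * T := mul_le_mul_of_nonneg_left (by linarith) hG
    linarith
  have key : ∀ ε, 0 < ε → v t ≤ σ (2 * ε) + (G * (T + 1) + σ (4 * (G * T))) ∨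
      v t ≤ v 0 + G * T - N * (G * T + ε) := fun ε hε => by
    rcases window_decay hσ hG hT h1 h2 hε.le N t hNle htb with h | h
    · left
      have := hσ.map_add_le (s := 2 * (G * T)) (t := ε) (by linarith) hε.le
      rw [show 2 * (2 * (G * T)) = 4 * (G * T) by ring] at this
      linarith
    · right
      linarith
  have hσ4 := hσ.nonneg (s := 4 * (G * T)) (by linarith)
  refine ⟨?_, fun ε hε htε => ?_⟩
  · refine le_of_forall_pos_le_add fun η hη => ?_
    obtain ⟨δ, hδ, hδη⟩ := hσ.exists_le hη
    rcases key (δ / 2) (half_pos hδ) with h | h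
    · have := hδη (2 * (δ / 2)) (by linarith) (by linarith)
      linarith [hv 0]
    · have : 0 ≤ (N : ℝ) * (G * T + δ / 2) := by positivity
      linarith
  · rcases key ε hε with h | h
    · exact h
    · have hNε : v 0 / ε + 1 < N + 1 := by
        refine lt_of_mul_lt_mul_left ?_ hT.le
        linarith
      have hNv : v 0 ≤ N * ε := by
        have := (div_lt_iff₀ hε).mp (by linarith : v 0 / ε < N)
        exact this.le
      have hσε := hσ.nonneg (s := 2 * ε) (by linarith)
      have : 0 ≤ (N : ℝ) * (G * T) := by positivity
      linarith

end Window

/-! ### Uniform estimates for solutions -/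

section Estimate

variable {Δ : ℝ≥0} {n m : ℕ}

/-- The growth condition at infinity, together with the positivity of `α` away from zero, bounds
`a₃` by a multiple of `α` up to an arbitrarily small constant. -/
theorem exists_le_add_mul {α a₃ : ℝ → ℝ} (hα : ClassKInf α) (ha₃ : ClassKInf a₃)
    (hgrowth : 0 < liminf (fun s : ℝ => ((α s / a₃ s : ℝ) : EReal)) atTop) {ε : ℝ} (hε : 0 < ε) :
    ∃ C, 0 ≤ C ∧ ∀ s, 0 ≤ s → a₃ s ≤ ε + C * α s := by
  obtain ⟨c, hc0, hc⟩ := EReal.lt_iff_exists_real_btwn.mp hgrowth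
  have hc0 : 0 < c := EReal.coe_lt_coe_iff.mp hc0
  obtain ⟨s₀, hs₀⟩ := eventually_atTop.mp ((eventually_lt_of_lt_liminf hc).and
    (eventually_gt_atTop 0))
  have hs₀0 : 0 < s₀ := (hs₀ s₀ le_rfl).2
  obtain ⟨δ, hδ, hδε⟩ := ha₃.classN.exists_le hε
  have hαδ := hα.toClassK.pos hδ
  have ha₃s₀ := ha₃.classN.nonneg hs₀0.le
  refine ⟨1 / c + a₃ s₀ / α δ, by positivity, fun s hs => ?_⟩
  have hαs := hα.classN.nonneg hs
  have hterm1 : 0 ≤ 1 / c * α s := by positivity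
  have hterm2 : 0 ≤ a₃ s₀ / α δ * α s := by positivity
  rw [add_mul]
  rcases le_total s δ with h | h
  · linarith [hδε s hs h]
  rcases le_total s₀ s with h' | h'
  · have h1 : c < α s / a₃ s := EReal.coe_lt_coe_iff.mp (hs₀ s h').1
    rw [lt_div_iff₀ (ha₃.toClassK.pos (hs₀0.trans_le h'))] at h1
    have : a₃ s ≤ 1 / c * α s := by
      rw [one_div, inv_mul_eq_div, le_div_iff₀ hc0]
      linarith
    linarith
  · have h1 : a₃ s₀ ≤ a₃ s₀ / α δ * α s := by
      rw [div_mul_eq_mul_div, le_div_iff₀ hαδ]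
      exact mul_le_mul_of_nonneg_left (hα.classN.mono hδ.le h) ha₃s₀
    linarith [ha₃.classN.mono hs h']

theorem continuous_comp_norm_value {a : ℝ → ℝ} (ha : ClassN a) (φ : History Δ n) :
    Continuous fun τ => a ‖value φ τ‖ :=
  continuous_comp_norm ha (continuous_value φ)

theorem integral_value_nonneg {a : ℝ → ℝ} (ha : ClassN a) (φ : History Δ n) :
    0 ≤ ∫ τ in (-(Δ : ℝ))..0, a ‖value φ τ‖ :=
  intervalIntegral.integral_nonneg (neg_delay_le Δ) fun _ _ => ha.nonneg (norm_nonneg _)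

/-- The functional is bounded in terms of the dissipation at the current time and its integral
over the delay interval. -/
theorem exists_coercive_bound {V : History Δ n → ℝ} {a₁ a₂ a₃ α : ℝ → ℝ}
    (ha₁ : ClassKInf a₁) (ha₂ : ClassKInf a₂) (ha₃ : ClassKInf a₃)
    (hupper : ∀ φ : History Δ n, V φ ≤ a₁ ‖current φ‖ +
      a₂ (∫ τ in (-(Δ : ℝ))..0, a₃ ‖value φ τ‖))
    (hα : ClassKInf α)
    (hgrowth : 0 < liminf (fun s : ℝ => ((α s / a₃ s : ℝ) : EReal)) atTop) :
    ∃ σ : ℝ → ℝ, ClassN σ ∧ ∀ (φ : History Δ n) (D : ℝ), α ‖current φ‖ ≤ D →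
      ∫ τ in (-(Δ : ℝ))..0, α ‖value φ τ‖ ≤ D → V φ ≤ σ D := by
  have hlin : ∀ ε, 0 < ε → ∃ C, 0 ≤ C ∧ ∀ φ : History Δ n,
      ∫ τ in (-(Δ : ℝ))..0, a₃ ‖value φ τ‖ ≤
        Δ * ε + C * ∫ τ in (-(Δ : ℝ))..0, α ‖value φ τ‖ := fun ε hε => by
    obtain ⟨C, hC0, hC⟩ := exists_le_add_mul hα ha₃ hgrowth hε
    refine ⟨C, hC0, fun φ => ?_⟩
    have hcα := (continuous_comp_norm_value hα.classN φ).const_mul C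
    refine (intervalIntegral.integral_mono_on (g := fun τ => ε + C * α ‖value φ τ‖)
      (neg_delay_le Δ) ((continuous_comp_norm_value ha₃.classN φ).intervalIntegrable _ _)
      ((continuous_const.add hcα).intervalIntegrable _ _)
      fun τ _ => hC _ (norm_nonneg (value φ τ))).trans_eq ?_
    rw [intervalIntegral.integral_add intervalIntegrable_const (hcα.intervalIntegrable _ _),
      intervalIntegral.integral_const, intervalIntegral.integral_const_mul]
    simp
  obtain ⟨ω, hω, hωle⟩ := exists_classN
    (fun φ : History Δ n => ∫ τ in (-(Δ : ℝ))..0, α ‖value φ τ‖)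
    (fun φ => ∫ τ in (-(Δ : ℝ))..0, a₃ ‖value φ τ‖)
    (fun ε hε => by
      have hΔ : (0 : ℝ) ≤ Δ := Δ.coe_nonneg
      obtain ⟨C, hC0, hC⟩ := hlin (ε / (2 * (Δ + 1))) (by positivity)
      refine ⟨ε / (2 * (C + 1)), by positivity, fun φ hφ => (hC φ).trans ?_⟩
      have h1 : (Δ : ℝ) * (ε / (2 * (Δ + 1))) ≤ ε / 2 := by
        rw [mul_div_assoc', div_le_div_iff₀ (by positivity) (by positivity)]
        nlinarith
      have h2 : C * (∫ τ in (-(Δ : ℝ))..0, α ‖value φ τ‖) ≤ ε / 2 := by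
        refine (mul_le_mul_of_nonneg_left hφ hC0).trans ?_
        rw [mul_div_assoc', div_le_div_iff₀ (by positivity) (by positivity)]
        nlinarith
      linarith)
    (fun M => by
      obtain ⟨C, hC0, hC⟩ := hlin 1 one_pos
      exact ⟨Δ * 1 + C * M, fun φ hφ => (hC φ).trans
        (add_le_add_right (mul_le_mul_of_nonneg_left hφ hC0) _)⟩)
  obtain ⟨ψ, hψ, hψle⟩ := hα.exists_inverse
  refine ⟨fun D => a₁ (ψ D) + a₂ (ω D), (ha₁.classN.comp hψ).add (ha₂.classN.comp hω),
    fun φ D h1 h2 => (hupper φ).trans (add_le_add ?_ ?_)⟩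
  · exact ha₁.classN.mono (norm_nonneg _) ((hψle _ (norm_nonneg _)).trans
      (hψ.mono (hα.classN.nonneg (norm_nonneg _)) h1))
  · have h3 := integral_value_nonneg hα.classN φ
    exact ha₂.classN.mono (integral_value_nonneg ha₃.classN φ)
      ((hωle φ h3).trans (hω.mono h3 h2))

theorem integral_value_segment {x : ℝ → Vec n} (hx : Continuous x) (a : ℝ → ℝ) (t : ℝ) :
    ∫ τ in (-(Δ : ℝ))..0, a ‖value (segment Δ x t) τ‖ = ∫ s in (t - Δ)..t, a ‖x s‖ := by
  have : ∫ τ in (-(Δ : ℝ))..0, a ‖value (segment Δ x t) τ‖ =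
      ∫ τ in (-(Δ : ℝ))..0, a ‖x (t + τ)‖ := by
    refine intervalIntegral.integral_congr fun τ hτ => ?_
    rw [Set.uIcc_of_le (neg_delay_le Δ)] at hτ
    simp only [value_segment hx t hτ]
  rw [this, intervalIntegral.integral_comp_add_left (fun s => a ‖x s‖), add_zero,
    ← sub_eq_add_neg]

/-- If the dissipation over the window `[t - Δ - 1, t]` is small, then it is small at some time
`τ ∈ [t - 1, t]` and over the whole delay interval before `τ`, so that the functional is small at
time `τ` and cannot have grown by more than `G` afterwards. -/
theorem le_of_window {V : History Δ n → ℝ} {α σ : ℝ → ℝ} (hα : ClassN α)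
    (hσV : ∀ (φ : History Δ n) (D : ℝ), α ‖current φ‖ ≤ D →
      ∫ τ in (-(Δ : ℝ))..0, α ‖value φ τ‖ ≤ D → V φ ≤ σ D)
    {x : ℝ → Vec n} (hx : Continuous x) {b G : ℝ} (hG : 0 ≤ G)
    (hV : ∀ s t, 0 ≤ s → s ≤ t → t ≤ b →
      V (segment Δ x t) + ∫ r in s..t, α ‖x r‖ ≤ V (segment Δ x s) + G * (t - s))
    {t : ℝ} (ht : Δ + 1 ≤ t) (htb : t ≤ b) :
    V (segment Δ x t) ≤
      σ (V (segment Δ x (t - (Δ + 1))) - V (segment Δ x t) + G * (Δ + 1)) + G := by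
  have hΔ : (0 : ℝ) ≤ Δ := Δ.coe_nonneg
  have hcont := continuous_comp_norm hα hx
  have hint : ∀ r s, IntervalIntegrable (fun r => α ‖x r‖) volume r s :=
    fun r s => hcont.intervalIntegrable r s
  have hnn : ∀ r, 0 ≤ α ‖x r‖ := fun r => hα.nonneg (norm_nonneg _)
  have hnn' : ∀ r s, r ≤ s → 0 ≤ ∫ r in r..s, α ‖x r‖ := fun r s hrs =>
    intervalIntegral.integral_nonneg hrs fun _ _ => hnn _
  have htotal := hV (t - (Δ + 1)) t (by linarith) (by linarith) htb
  rw [sub_sub_cancel] at htotal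
  have hpart : ∀ r s, t - (Δ + 1) ≤ r → r ≤ s → s ≤ t →
      ∫ r in r..s, α ‖x r‖ ≤ ∫ r in (t - (Δ + 1))..t, α ‖x r‖ := fun r s hr hrs hs =>
    intervalIntegral.integral_mono_interval hr hrs hs (Eventually.of_forall hnn) (hint _ _)
  obtain ⟨τ, hτ, hmin⟩ := isCompact_Icc.exists_isMinOn (s := Set.Icc (t - 1) t)
    ⟨t, by linarith, le_rfl⟩ hcont.continuousOn
  have hατ : α ‖x τ‖ ≤ ∫ r in (t - 1)..t, α ‖x r‖ := by
    have := intervalIntegral.integral_mono_on (μ := volume) (f := fun _ => α ‖x τ‖)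
      (by linarith : t - 1 ≤ t) intervalIntegrable_const (hint _ _) fun r hr => hmin hr
    simpa using this
  have hτV := hσV (segment Δ x τ) (V (segment Δ x (t - (Δ + 1))) - V (segment Δ x t) +
    G * (Δ + 1)) (by
      rw [current_segment hx]
      linarith [hpart (t - 1) t (by linarith) (by linarith) le_rfl]) (by
      rw [integral_value_segment hx]
      linarith [hpart (τ - Δ) τ (by linarith [hτ.1]) (by linarith) hτ.2])
  have hlast := hV τ t (by linarith [hτ.1]) hτ.2 htb
  have : G * (t - τ) ≤ G * 1 := mul_le_mul_of_nonneg_left (by linarith [hτ.1]) hG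
  linarith [hnn' τ t hτ.2]

/-- Quantitative stability of all solutions, on their whole interval of existence: a bound by the
size of the initial state, and a bound by any prescribed level `ε` after a time which depends only
on `ε` and the size of the initial state; in both cases up to a gain `μ` of the input. -/
theorem exists_uniform_estimate {f : History Δ n → Vec m → Vec n}
    (hf : FieldLipschitzOnBounded f) (hf0 : f 0 0 = 0)
    {V : History Δ n → ℝ} (hV : IsLKF V) {aLow a₁ a₂ a₃ α γ : ℝ → ℝ}
    (haLow : ClassKInf aLow) (ha₁ : ClassKInf a₁) (ha₂ : ClassKInf a₂) (ha₃ : ClassKInf a₃)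
    (hlower : ∀ φ : History Δ n, aLow ‖current φ‖ ≤ V φ)
    (hupper : ∀ φ : History Δ n, V φ ≤ a₁ ‖current φ‖ +
      a₂ (∫ τ in (-(Δ : ℝ))..0, a₃ ‖value φ τ‖))
    (hα : ClassKInf α) (hγ : ClassN γ)
    (hdiss : ∀ (φ : History Δ n) (v : Vec m),
      driverDeriv V φ (f φ v) ≤ ((-α ‖current φ‖ + γ ‖v‖ : ℝ) : EReal))
    (hgrowth : 0 < liminf (fun s : ℝ => ((α s / a₃ s : ℝ) : EReal)) atTop) :
    ∃ (κ μ ρ : ℝ → ℝ) (θ : ℝ → ℝ → ℝ), ClassN κ ∧ ClassN μ ∧ ClassN ρ ∧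
      (∀ ε, 0 < ε → MonotoneOn (fun s => θ s ε) (Set.Ici 0)) ∧
      ∀ (φ : History Δ n) (u : ℝ → Vec m), IsInput u → ∀ (T : EReal) (x : ℝ → Vec n),
        IsSolution f φ u T x → ∀ t : ℝ, 0 ≤ t → (t : EReal) < T →
          ‖x t‖ ≤ κ ‖φ‖ + μ (inputNorm u t) ∧
          ∀ ε, 0 < ε → θ ‖φ‖ ε ≤ t → ‖x t‖ ≤ ρ ε + μ (inputNorm u t) := by
  obtain ⟨_, B, _, hB, hbounds⟩ := hV.bounds
  obtain ⟨σ, hσ, hσV⟩ := exists_coercive_bound ha₁ ha₂ ha₃ hupper hα hgrowth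
  obtain ⟨ψ, hψ, hψle⟩ := haLow.exists_inverse
  have hT : (0 : ℝ) < Δ + 1 := by positivity
  -- The bound of `window_bound` with `T = Δ + 1` and `G = γ s`, as a function of the input norm.
  let A : ℝ → ℝ := fun s => (Δ + 1 + 1) * γ s + σ ((4 * (Δ + 1)) * γ s)
  have hA : ClassN A :=
    (hγ.const_mul (by positivity)).add (hσ.comp (hγ.const_mul (by positivity)))
  have htime : ∀ {p q ε : ℝ}, 0 < ε → p ≤ q →
      ((Δ : ℝ) + 1) * (p / ε + 1) ≤ (Δ + 1) * (q / ε + 1) := fun hε hpq => by gcongr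
  refine ⟨fun s => ψ (2 * B s), fun s => ψ (2 * A s), fun s => ψ (2 * σ (2 * s)),
    fun s ε => (Δ + 1) * (B s / ε + 1), hψ.comp (hB.classN.const_mul zero_le_two),
    hψ.comp (hA.const_mul zero_le_two), ?_, fun ε hε s hs s' hs' hss => ?_,
    fun φ u hu T x hx t ht htT => ?_⟩
  · refine hψ.comp ((hσ.comp (b := fun s => 2 * s) ?_).const_mul zero_le_two)
    exact ⟨by fun_prop, mul_zero _, fun s _ t _ h => mul_le_mul_of_nonneg_left h zero_le_two⟩
  · exact htime hε (hB.classN.mono hs hss)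
  obtain ⟨y, hy, hyx, hy0, hint, heq⟩ := hx.exists_continuous ht htT
  set r := inputNorm u t
  have hr0 : 0 ≤ r := inputNorm_nonneg u t
  have hG : 0 ≤ γ r := hγ.nonneg hr0
  have hdis : ∀ a c, 0 ≤ a → a ≤ c → c ≤ t →
      V (segment Δ y c) + ∫ r in a..c, α ‖y r‖ ≤ V (segment Δ y a) + γ r * (c - a) := by
    intro a c ha hac hct
    have h := dissipation_of_integral_eq hf hf0 hV.lipschitz hα.classN hγ hdiss hy ha hac hr0
      (by
        filter_upwards [hu.ae_norm_le ht] with s hs hsc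
        exact hs ⟨hsc.1, hsc.2.trans hct⟩)
      (hint.mono_set (by
        rw [Set.uIcc_of_le ht, Set.uIcc_of_le (ha.trans hac)]
        exact Set.Icc_subset_Icc_right hct))
      fun s hs => heq s ⟨hs.1, hs.2.trans hct⟩
    rw [intervalIntegral.integral_sub intervalIntegrable_const
      ((continuous_comp_norm hα.classN hy).intervalIntegrable _ _),
      intervalIntegral.integral_const, smul_eq_mul, mul_comm (c - a)] at h
    linarith
  have hwin := window_bound (v := fun s => V (segment Δ y s)) (b := t) hσ hG hT
    (fun s => hV.nonneg _) (fun a c ha hac hct => by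
      have h1 := hdis a c ha hac hct
      have h2 : 0 ≤ ∫ r in a..c, α ‖y r‖ :=
        intervalIntegral.integral_nonneg hac fun _ _ => hα.classN.nonneg (norm_nonneg _)
      linarith)
    (fun s hs hst => le_of_window hα.classN hσV hy hG hdis hs hst) ht le_rfl
  have hAr : γ r * (Δ + 1 + 1) + σ (4 * (γ r * (Δ + 1))) = A r := by
    simp only [A]
    ring_nf
  simp only [hAr, hy0] at hwin
  have hAr0 : 0 ≤ A r := hA.nonneg hr0
  have hfinal : ∀ c, 0 ≤ c → V (segment Δ y t) ≤ c + A r → ‖x t‖ ≤ ψ (2 * c) + ψ (2 * A r) := by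
    intro c hc h
    rw [← hyx t ⟨(neg_delay_le Δ).trans ht, le_rfl⟩]
    refine (hψle _ (norm_nonneg _)).trans (le_trans ?_ (hψ.map_add_le hc hAr0))
    refine hψ.mono (haLow.classN.nonneg (norm_nonneg _)) (le_trans ?_ h)
    have := hlower (segment Δ y t)
    rwa [current_segment hy] at this
  have hVB := (hbounds φ).2
  refine ⟨hfinal _ (hB.classN.nonneg (norm_nonneg _)) (by linarith [hwin.1]),
    fun ε hε htε => hfinal _ (hσ.nonneg (by linarith)) (hwin.2 ε hε ((htime hε hVB).trans htε))⟩

end Estimate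

/-! ### Global solutions of Lipschitz delay equations -/

section Picard

variable {Δ : ℝ≥0} {n m : ℕ}

theorem norm_segment_sub_le {x y : ℝ → Vec n} (hx : Continuous x) (hy : Continuous y) {t C : ℝ}
    (hC : 0 ≤ C) (h : ∀ s ≤ t, ‖x s - y s‖ ≤ C) : ‖segment Δ x t - segment Δ y t‖ ≤ C := by
  refine (ContinuousMap.norm_le _ hC).mpr fun τ => ?_
  rw [ContinuousMap.sub_apply, segment_apply_of_continuous hx, segment_apply_of_continuous hy]
  exact h _ (by linarith [τ.2.2])

theorem value_of_nonneg (φ : History Δ n) {t : ℝ} (ht : 0 ≤ t) : value φ t = current φ := by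
  rw [value, Set.projIcc_of_right_le _ ht]
  rfl

/-- The Picard operator of the delay equation `x'(t) = F t x_t` with initial state `φ`, acting on
curves `ℝ → ℝⁿ`. -/
noncomputable def picard (F : ℝ → History Δ n → Vec n) (φ : History Δ n) (x : ℝ → Vec n) (t : ℝ) :
    Vec n :=
  value φ t + ∫ s in (0 : ℝ)..max t 0, F s (segment Δ x s)

theorem picard_of_nonpos (F : ℝ → History Δ n → Vec n) (φ : History Δ n) (x : ℝ → Vec n) {t : ℝ}
    (ht : t ≤ 0) : picard F φ x t = value φ t := by
  rw [picard, max_eq_right ht, intervalIntegral.integral_same, add_zero]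

theorem continuous_picard {F : ℝ → History Δ n → Vec n} (φ : History Δ n) {x : ℝ → Vec n}
    (hint : ∀ b, 0 ≤ b → IntervalIntegrable (fun s => F s (segment Δ x s)) volume 0 b) :
    Continuous (picard F φ x) := by
  refine (continuous_value φ).add ?_
  have hP : ContinuousOn (fun t => ∫ s in (0 : ℝ)..t, F s (segment Δ x s)) (Set.Ici 0) := by
    intro t ht
    have ht0 : (0 : ℝ) ≤ t := ht
    have h := intervalIntegral.continuousOn_primitive_interval' (hint (t + 1) (by linarith))
      Set.left_mem_uIcc
    rw [Set.uIcc_of_le (by linarith)] at h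
    refine (h t ⟨ht0, by linarith⟩).mono_of_mem_nhdsWithin ?_
    filter_upwards [self_mem_nhdsWithin,
      nhdsWithin_le_nhds (eventually_le_nhds (lt_add_one t))] with s hs hs'
    exact ⟨hs, hs'⟩
  exact hP.comp_continuous (by fun_prop) fun t => le_max_right t 0

/-- Picard iteration: if `F s` is Lipschitz for almost every `s`, with a constant which is locally
uniform in `s`, then the equation `x'(t) = F t x_t` has a solution on `[0, ∞)`. The iterates
converge uniformly on each `(-∞, b]`, since successive differences are bounded by the terms
`M (L b)ᵏ / k!` of an exponential series. -/
theorem exists_global_integral_eq {F : ℝ → History Δ n → Vec n} (φ : History Δ n)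
    (hint : ∀ x : ℝ → Vec n, Continuous x → ∀ b, 0 ≤ b →
      IntervalIntegrable (fun s => F s (segment Δ x s)) volume 0 b)
    (hLip : ∀ b, 0 ≤ b → ∃ L, 0 ≤ L ∧ ∀ᵐ s, s ∈ Set.Icc 0 b →
      ∀ φ₁ φ₂, ‖F s φ₁ - F s φ₂‖ ≤ L * ‖φ₁ - φ₂‖) :
    ∃ x : ℝ → Vec n, Continuous x ∧ segment Δ x 0 = φ ∧
      ∀ t, 0 ≤ t → x t = current φ + ∫ s in (0 : ℝ)..t, F s (segment Δ x s) := by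
  let X : ℕ → ℝ → Vec n := fun k => (picard F φ)^[k] (value φ)
  have hXs : ∀ k, X (k + 1) = picard F φ (X k) := fun k => Function.iterate_succ_apply' _ _ _
  have hXc : ∀ k, Continuous (X k) := by
    intro k
    induction k with
    | zero => exact continuous_value φ
    | succ k ih => rw [hXs]; exact continuous_picard φ (hint _ ih)
  have hX0 : ∀ k t, t ≤ 0 → X k t = value φ t := by
    intro k t ht
    cases k with
    | zero => rfl
    | succ k => rw [hXs, picard_of_nonpos F φ _ ht]
  have hint_diff : ∀ {x y : ℝ → Vec n}, Continuous x → Continuous y → ∀ {b L e : ℝ} {g : ℝ → ℝ},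
      0 ≤ b → Continuous g → (∀ s ∈ Set.Icc 0 b, ‖segment Δ x s - segment Δ y s‖ ≤ g s) →
      0 ≤ L → (∀ᵐ s, s ∈ Set.Icc 0 e → ∀ φ₁ φ₂, ‖F s φ₁ - F s φ₂‖ ≤ L * ‖φ₁ - φ₂‖) → b ≤ e →
      ‖(∫ s in (0 : ℝ)..b, F s (segment Δ x s)) - ∫ s in (0 : ℝ)..b, F s (segment Δ y s)‖ ≤
        ∫ s in (0 : ℝ)..b, L * g s := by
    intro x y hx hy b L e g hb hg hxy hL0 hL hbe
    rw [← intervalIntegral.integral_sub (hint x hx b hb) (hint y hy b hb)]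
    refine intervalIntegral.norm_integral_le_of_norm_le hb ?_
      ((hg.const_mul L).intervalIntegrable _ _)
    filter_upwards [hL] with s hs hsb
    exact (hs ⟨hsb.1.le, hsb.2.trans hbe⟩ _ _).trans
      (mul_le_mul_of_nonneg_left (hxy s ⟨hsb.1.le, hsb.2⟩) hL0)
  have hstep : ∀ b, 0 ≤ b → ∃ d : ℕ → ℝ, Summable d ∧
      ∀ k, ∀ t ≤ b, dist (X k t) (X (k + 1) t) ≤ d k := by
    intro b hb
    obtain ⟨L, hL0, hL⟩ := hLip b hb
    obtain ⟨M, hM⟩ := isCompact_Icc.exists_bound_of_continuousOn (s := Set.Icc 0 b)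
      ((hXc 1).sub (hXc 0)).continuousOn
    have hM0 : 0 ≤ M := (norm_nonneg _).trans (hM 0 ⟨le_rfl, hb⟩)
    have key : ∀ k : ℕ, ∀ t ≤ b,
        ‖X (k + 1) t - X k t‖ ≤ M * ((L * max t 0) ^ k / k.factorial) := by
      intro k
      induction k with
      | zero =>
        intro t ht
        rw [pow_zero, Nat.factorial_zero, Nat.cast_one, div_one, mul_one]
        rcases le_total t 0 with h | h
        · rw [hX0 _ t h, hX0 _ t h, sub_self, norm_zero]
          exact hM0
        · exact hM t ⟨h, ht⟩
      | succ k ih =>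
        intro t ht
        rcases le_total t 0 with h | h
        · rw [hX0 _ t h, hX0 _ t h, sub_self, norm_zero]
          positivity
        rw [hXs (k + 1), hXs k, picard, picard, add_sub_add_left_eq_sub, ← hXs k, max_eq_left h]
        refine (hint_diff (g := fun s => M * ((L * s) ^ k / k.factorial)) (hXc _) (hXc _) h
          (by fun_prop) (fun s hs => ?_) hL0 hL ht).trans_eq ?_
        · have hs0 := hs.1
          refine norm_segment_sub_le (hXc _) (hXc _) (by positivity) fun r hr => ?_
          refine (ih r (hr.trans (hs.2.trans ht))).trans ?_
          have : max r 0 ≤ s := max_le hr hs0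
          gcongr
        · have : (fun s : ℝ => L * (M * ((L * s) ^ k / k.factorial))) =
              fun s => (M * L ^ (k + 1) / k.factorial) * s ^ k := by
            funext s
            rw [mul_pow]
            ring
          rw [this, intervalIntegral.integral_const_mul, integral_pow, Nat.factorial_succ]
          push_cast
          field_simp
          ring
    refine ⟨fun k => M * ((L * b) ^ k / k.factorial),
      (Real.summable_pow_div_factorial (L * b)).mul_left M, fun k t ht => ?_⟩
    rw [dist_comm, dist_eq_norm]
    refine (key k t ht).trans ?_
    have : max t 0 ≤ b := max_le ht hb
    have h0 : 0 ≤ max t 0 := le_max_right t 0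
    dsimp only
    gcongr
  choose! d hd hXd using hstep
  have hlim : ∀ t, ∃ y, Tendsto (fun k => X k t) atTop (𝓝 y) := by
    intro t
    refine cauchySeq_tendsto_of_complete (cauchySeq_of_dist_le_of_summable (d |t|) (fun k => ?_)
      (hd _ (abs_nonneg t)))
    exact hXd _ (abs_nonneg t) k t (le_abs_self t)
  choose x hx using hlim
  have hrate : ∀ b, 0 ≤ b → ∀ k, ∀ t ≤ b, dist (X k t) (x t) ≤ ∑' j, d b (k + j) :=
    fun b hb k t ht => dist_le_tsum_of_dist_le_of_tendsto (d b) (fun j => hXd b hb j t ht)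
      (hd b hb) (hx t) k
  have htail : ∀ b, Tendsto (fun k => ∑' j, d b (k + j)) atTop (𝓝 0) := fun b => by
    simpa only [add_comm] using tendsto_sum_nat_add (d b)
  have hxc : Continuous x := by
    refine TendstoLocallyUniformly.continuous (F := X) (p := atTop) ?_
      (Frequently.of_forall hXc)
    refine Metric.tendstoLocallyUniformly_iff.mpr fun ε hε t => ⟨Set.Iio (|t| + 1),
      Iio_mem_nhds (by linarith [le_abs_self t]), ?_⟩
    filter_upwards [(htail (|t| + 1)).eventually (eventually_lt_nhds hε)] with k hk s hs
    rw [dist_comm]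
    exact (hrate _ (by positivity) k s (le_of_lt hs)).trans_lt hk
  have hx0 : ∀ t ≤ 0, x t = value φ t := fun t ht =>
    tendsto_nhds_unique (hx t) (tendsto_const_nhds.congr fun k => (hX0 k t ht).symm)
  refine ⟨x, hxc, ?_, fun t ht => ?_⟩
  · ext1 τ
    rw [segment_apply_of_continuous hxc, zero_add, hx0 _ τ.2.2, value_of_mem φ τ.2]
  · obtain ⟨L, hL0, hL⟩ := hLip t ht
    have hI : Tendsto (fun k => ∫ s in (0 : ℝ)..t, F s (segment Δ (X k) s)) atTop
        (𝓝 (∫ s in (0 : ℝ)..t, F s (segment Δ x s))) := by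
      rw [tendsto_iff_norm_sub_tendsto_zero]
      have hzero : Tendsto (fun k => ∫ s in (0 : ℝ)..t, L * ∑' j, d t (k + j)) atTop (𝓝 0) := by
        simp only [intervalIntegral.integral_const, smul_eq_mul]
        simpa using ((htail t).const_mul L).const_mul (t - 0)
      refine squeeze_zero (fun _ => norm_nonneg _) (fun k => ?_) hzero
      have hr := hrate t ht k
      refine hint_diff (g := fun _ => ∑' j, d t (k + j)) (hXc k) hxc ht continuous_const
        (fun s hs => ?_) hL0 hL le_rfl
      refine norm_segment_sub_le (hXc k) hxc (dist_nonneg.trans (hr t le_rfl)) fun r hrs => ?_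
      rw [← dist_eq_norm]
      exact hr r (hrs.trans hs.2)
    refine tendsto_nhds_unique ((hx t).comp (tendsto_add_atTop_nat 1))
      ((hI.const_add (current φ)).congr fun k => ?_)
    simp only [Function.comp_apply, hXs, picard, max_eq_left ht, value_of_nonneg φ ht]

/-! ### Truncation and global existence -/

/-- The radial retraction of a normed space onto the ball of radius `R > 0`. -/
noncomputable def truncate {E : Type*} [NormedAddCommGroup E] [NormedSpace ℝ E] (R : ℝ) (φ : E) :
    E := (R / max R ‖φ‖) • φ

section Truncate

variable {E : Type*} [NormedAddCommGroup E] [NormedSpace ℝ E] {R : ℝ}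

theorem truncate_of_le (hR : 0 < R) {φ : E} (h : ‖φ‖ ≤ R) : truncate R φ = φ := by
  rw [truncate, max_eq_left h, div_self hR.ne', one_smul]

theorem norm_truncate_le (hR : 0 < R) (φ : E) : ‖truncate R φ‖ ≤ R := by
  have hpos : 0 < max R ‖φ‖ := hR.trans_le (le_max_left _ _)
  rw [truncate, norm_smul, Real.norm_of_nonneg (by positivity), div_mul_eq_mul_div,
    div_le_iff₀ hpos]
  exact mul_le_mul_of_nonneg_left (le_max_right _ _) hR.le

theorem norm_truncate_sub_le (hR : 0 < R) (φ ψ : E) :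
    ‖truncate R φ - truncate R ψ‖ ≤ 2 * ‖φ - ψ‖ := by
  set p := max R ‖φ‖ with hp
  set q := max R ‖ψ‖ with hq
  have hp0 : 0 < p := hR.trans_le (le_max_left _ _)
  have hq0 : 0 < q := hR.trans_le (le_max_left _ _)
  have hpq : |q - p| ≤ ‖φ - ψ‖ := by
    rw [hp, hq, max_comm R, max_comm R]
    refine (abs_max_sub_max_le_abs _ _ _).trans ?_
    rw [abs_sub_comm]
    exact abs_norm_sub_norm_le φ ψ
  have hsplit : truncate R φ - truncate R ψ =
      (R / p) • (φ - ψ) + (R / p - R / q) • ψ := by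
    rw [truncate, truncate, smul_sub, sub_smul]
    abel
  have h1 : ‖(R / p) • (φ - ψ)‖ ≤ ‖φ - ψ‖ := by
    rw [norm_smul, Real.norm_of_nonneg (by positivity)]
    exact mul_le_of_le_one_left (norm_nonneg _) ((div_le_one hp0).mpr (le_max_left _ _))
  have h2 : ‖(R / p - R / q) • ψ‖ ≤ ‖φ - ψ‖ := by
    have heq : R / p - R / q = (R / p) * ((q - p) / q) := by field_simp
    rw [norm_smul, heq, Real.norm_eq_abs, abs_mul, abs_of_nonneg (by positivity : 0 ≤ R / p),
      abs_div, abs_of_pos hq0, mul_assoc, div_mul_eq_mul_div |q - p|]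
    have h3 : |q - p| * ‖ψ‖ / q ≤ |q - p| := by
      rw [div_le_iff₀ hq0]
      exact mul_le_mul_of_nonneg_left (le_max_right _ _) (abs_nonneg _)
    have h4 : 0 ≤ |q - p| * ‖ψ‖ / q := by positivity
    exact (mul_le_of_le_one_left h4 ((div_le_one hp0).mpr (le_max_left _ _))).trans
      (h3.trans hpq)
  rw [hsplit]
  exact (norm_add_le _ _).trans (by linarith)

end Truncate

/-- A monotone a priori bound for all solutions entails global existence: the equation truncated
at a level above the bound has a global solution, which never reaches that level. -/
theorem exists_global_solution {f : History Δ n → Vec m → Vec n}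
    (hf : FieldLipschitzOnBounded f) (hf0 : f 0 0 = 0) {φ : History Δ n} {u : ℝ → Vec m}
    (hu : IsInput u) {K : ℝ → ℝ} (hK : Monotone K) (hφK : ∀ t, ‖φ‖ ≤ K t)
    (hapriori : ∀ (T : EReal) (x : ℝ → Vec n), IsSolution f φ u T x →
      ∀ t : ℝ, 0 ≤ t → (t : EReal) < T → ‖x t‖ ≤ K t) :
    ∃ x : ℝ → Vec n, IsSolution f φ u ⊤ x := by
  let R : ℝ → ℝ := fun t => K t + 1
  have hR : Monotone R := hK.add_const 1
  have hR0 : ∀ t, 0 < R t := fun t => by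
    have := (norm_nonneg φ).trans (hφK t)
    positivity
  let F : ℝ → History Δ n → Vec n := fun s ψ => f (truncate (R s) ψ) (u s)
  have hint : ∀ x : ℝ → Vec n, Continuous x → ∀ b, 0 ≤ b →
      IntervalIntegrable (fun s => F s (segment Δ x s)) volume 0 b := by
    intro x hx b hb
    obtain ⟨C, -, hC⟩ := hf.exists_bound hf0 (max (R b) (inputNorm u b))
    rw [intervalIntegrable_iff_integrableOn_Ioc_of_le hb]
    have hseg := continuous_segment (Δ := Δ) hx
    have hmeas : AEStronglyMeasurable (fun s => truncate (R s) (segment Δ x s))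
        (volume.restrict (Set.Ioc 0 b)) :=
      (hR.measurable.div (hR.measurable.max hseg.norm.measurable)).aestronglyMeasurable.smul
        hseg.aestronglyMeasurable
    have humeas : AEStronglyMeasurable u (volume.restrict (Set.Ioc 0 b)) :=
      (hu b hb).aestronglyMeasurable.mono_measure
        (Measure.restrict_mono Set.Ioc_subset_Icc_self le_rfl)
    refine IntegrableOn.of_bound (by simp)
      (hf.continuous.comp_aestronglyMeasurable (hmeas.prodMk humeas)) C ?_
    rw [ae_restrict_iff' measurableSet_Ioc]
    filter_upwards [hu.ae_norm_le hb] with s hs hsb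
    exact hC _ _ ((norm_truncate_le (hR0 s) _).trans ((hR hsb.2).trans (le_max_left _ _)))
      ((hs (Set.Ioc_subset_Icc_self hsb)).trans (le_max_right _ _))
  have hLip : ∀ b, 0 ≤ b → ∃ L, 0 ≤ L ∧ ∀ᵐ s, s ∈ Set.Icc 0 b →
      ∀ φ₁ φ₂, ‖F s φ₁ - F s φ₂‖ ≤ L * ‖φ₁ - φ₂‖ := by
    intro b hb
    obtain ⟨L, hL0, hL⟩ := hf (max (R b) (inputNorm u b)) ((hR0 b).trans_le (le_max_left _ _))
    refine ⟨2 * L, by positivity, ?_⟩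
    filter_upwards [hu.ae_norm_le hb] with s hs hsb φ₁ φ₂
    have hus := (hs hsb).trans (le_max_right (R b) _)
    have htr : ∀ ψ : History Δ n, ‖truncate (R s) ψ‖ ≤ max (R b) (inputNorm u b) := fun ψ =>
      (norm_truncate_le (hR0 s) _).trans ((hR hsb.2).trans (le_max_left _ _))
    refine (hL _ _ _ _ (htr φ₁) (htr φ₂) hus hus).trans ?_
    rw [sub_self, norm_zero, add_zero, mul_comm 2 L, mul_assoc]
    exact mul_le_mul_of_nonneg_left (norm_truncate_sub_le (hR0 s) _ _) hL0.le
  obtain ⟨x, hx, hx0, hxeq⟩ := exists_global_integral_eq φ hint hLip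
  have hseg : Continuous (segment Δ x) := continuous_segment hx
  have hinit : ∀ τ : Set.Icc (-(Δ : ℝ)) 0, x τ = φ τ := fun τ => by
    rw [← hx0, segment_apply_of_continuous hx, zero_add]
  have hsol : ∀ T : EReal, 0 < T → (∀ s : ℝ, 0 ≤ s → (s : EReal) < T → ‖segment Δ x s‖ ≤ R s) →
      IsSolution f φ u T x := by
    intro T hT h
    have hF : ∀ t : ℝ, 0 ≤ t → (t : EReal) < T → ∀ s ∈ Set.uIcc 0 t,
        F s (segment Δ x s) = f (segment Δ x s) (u s) := fun t ht htT s hs => by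
      rw [Set.uIcc_of_le ht] at hs
      simp only [F]
      rw [truncate_of_le (hR0 s) (h s hs.1 ((EReal.coe_le_coe_iff.mpr hs.2).trans_lt htT))]
    refine ⟨hT, hx.continuousOn, hinit, fun t ht htT => ?_, fun t ht htT => ?_⟩
    · exact (hint x hx t ht).congr fun s hs => hF t ht htT s (Set.uIoc_subset_uIcc hs)
    · rw [hxeq t ht, intervalIntegral.integral_congr (hF t ht htT)]
  -- Before reaching the truncation level, the curve solves the original equation, so that it obeys
  -- the a priori bound, up to and including the time `c` by continuity.
  have hstay : ∀ c, 0 ≤ c → (∀ s, 0 ≤ s → s < c → ‖segment Δ x s‖ ≤ R s) →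
      ‖segment Δ x c‖ ≤ K c := by
    intro c hc h
    have hK0 : 0 ≤ K c := (norm_nonneg φ).trans (hφK c)
    rcases hc.eq_or_lt with rfl | hc0
    · rw [hx0]
      exact hφK 0
    have hc_sol := hsol c (EReal.coe_pos.mpr hc0) fun s hs hsc =>
      h s hs (EReal.coe_lt_coe_iff.mp hsc)
    have hlt : ∀ s, 0 ≤ s → s < c → ‖x s‖ ≤ K c := fun s hs hsc =>
      (hapriori c x hc_sol s hs (EReal.coe_lt_coe_iff.mpr hsc)).trans (hK hsc.le)
    refine norm_segment_le hx hK0 fun s hs => ?_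
    rcases le_or_gt s 0 with hs0 | hs0
    · rcases lt_or_ge s (-(Δ : ℝ)) with hsΔ | hsΔ
      · linarith [hs.1]
      · rw [hinit ⟨s, hsΔ, hs0⟩]
        exact (φ.norm_coe_le_norm _).trans (hφK c)
    rcases hs.2.eq_or_lt with rfl | hsc
    · refine le_of_tendsto (hx.norm.continuousAt.mono_left nhdsWithin_le_nhds :
        Tendsto (fun r => ‖x r‖) (𝓝[<] s) _) ?_
      filter_upwards [Ioo_mem_nhdsLT hs0] with r hr using hlt r hr.1.le hr.2
    · exact hlt s hs0.le hsc
  have hall : ∀ t, 0 ≤ t → ‖segment Δ x t‖ ≤ R t := by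
    by_contra! hcon
    let S : Set ℝ := {t | 0 ≤ t ∧ R t < ‖segment Δ x t‖}
    have hS : S.Nonempty := hcon
    have hSb : BddBelow S := ⟨0, fun t ht => ht.1⟩
    -- `K` may jump, but only upwards: the bound `K c` at the infimum `c` of the exit times still
    -- prevents an exit shortly after `c`.
    set c := sInf S
    have hc0 : 0 ≤ c := le_csInf hS fun t ht => ht.1
    have hcK := hstay c hc0 fun s hs hsc => not_lt.mp fun hlt =>
      absurd (csInf_le hSb ⟨hs, hlt⟩) (not_le.mpr hsc)
    have hev : ∀ᶠ t in 𝓝 c, ‖segment Δ x t‖ < R c :=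
      hseg.norm.continuousAt.eventually (eventually_lt_nhds (hcK.trans_lt (lt_add_one _)))
    obtain ⟨δ, hδ, hball⟩ := Metric.eventually_nhds_iff.mp hev
    obtain ⟨t, ht, htc⟩ := exists_lt_of_csInf_lt hS (lt_add_of_pos_right c hδ)
    have hct : c ≤ t := csInf_le hSb ht
    have := hball (y := t) (by rw [Real.dist_eq, abs_of_nonneg (sub_nonneg.mpr hct)]; linarith)
    linarith [ht.2, hR hct]
  exact ⟨x, hsol ⊤ EReal.zero_lt_top fun s hs _ => hall s hs⟩

end Picard

end TimeDelay

theorem mainTheorem2 {Δ : NNReal} {n m : ℕ}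
    (f : TimeDelay.History Δ n → TimeDelay.Vec m → TimeDelay.Vec n)
    (hf : TimeDelay.FieldLipschitzOnBounded f) (hf0 : f 0 0 = 0)
    (V : TimeDelay.History Δ n → ℝ) (hV : TimeDelay.IsLKF V)
    (aLow a₁ a₂ a₃ α γ : ℝ → ℝ)
    (haLow : TimeDelay.ClassKInf aLow) (ha₁ : TimeDelay.ClassKInf a₁)
    (ha₂ : TimeDelay.ClassKInf a₂) (ha₃ : TimeDelay.ClassKInf a₃)
    (hlower : ∀ φ : TimeDelay.History Δ n, aLow ‖TimeDelay.current φ‖ ≤ V φ)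
    (hupper : ∀ φ : TimeDelay.History Δ n, V φ ≤ a₁ ‖TimeDelay.current φ‖ +
      a₂ (∫ τ in (-(Δ : ℝ))..0, a₃ ‖TimeDelay.value φ τ‖))
    (hα : TimeDelay.ClassKInf α) (hγ : TimeDelay.ClassN γ)
    (hdiss : ∀ (φ : TimeDelay.History Δ n) (v : TimeDelay.Vec m),
      TimeDelay.driverDeriv V φ (f φ v) ≤
        ((-α ‖TimeDelay.current φ‖ + γ ‖v‖ : ℝ) : EReal))
    (hgrowth : 0 < Filter.liminf (fun s : ℝ => ((α s / a₃ s : ℝ) : EReal)) Filter.atTop) :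
    TimeDelay.ISS f := by
  obtain ⟨κ, μ, ρ, θ, hκ, hμ, hρ, hθ, hest⟩ := TimeDelay.exists_uniform_estimate hf hf0 hV haLow
    ha₁ ha₂ ha₃ hlower hupper hα hγ hdiss hgrowth
  -- All triples of initial norm, time, and excess of a solution over the input gain.
  let Q : ℝ → ℝ → ℝ → Prop := fun s t y =>
    ∃ (φ : TimeDelay.History Δ n) (u : ℝ → TimeDelay.Vec m) (T : EReal)
      (x : ℝ → TimeDelay.Vec n), TimeDelay.IsInput u ∧ TimeDelay.IsSolution f φ u T x ∧ 0 ≤ t ∧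
        (t : EReal) < T ∧ s = ‖φ‖ ∧ y = ‖x t‖ - μ (TimeDelay.inputNorm u t)
  have hbdd : ∀ M, ∃ B, ∀ s t y, Q s t y → s ≤ M → y ≤ B := by
    refine fun M => ⟨κ M, ?_⟩
    rintro _ t _ ⟨φ, u, T, x, hu, hx, ht, htT, rfl, rfl⟩ hM
    have := (hest φ u hu T x hx t ht htT).1
    linarith [hκ.mono (norm_nonneg φ) hM]
  have hsmall : ∀ ε, 0 < ε → ∃ δ, 0 < δ ∧ ∀ s t y, Q s t y → s ≤ δ → y ≤ ε := by
    intro ε hε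
    obtain ⟨δ, hδ, h⟩ := hκ.exists_le hε
    refine ⟨δ, hδ, ?_⟩
    rintro _ t _ ⟨φ, u, T, x, hu, hx, ht, htT, rfl, rfl⟩ hM
    have := (hest φ u hu T x hx t ht htT).1
    linarith [h _ (norm_nonneg φ) hM]
  have hlim : ∀ M ε, 0 < ε → ∃ S, ∀ s t y, Q s t y → s ≤ M → S ≤ t → y ≤ ε := by
    intro M ε hε
    obtain ⟨δ, hδ, h⟩ := hρ.exists_le hε
    refine ⟨θ M δ, ?_⟩
    rintro _ t _ ⟨φ, u, T, x, hu, hx, ht, htT, rfl, rfl⟩ hM hMt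
    have := (hest φ u hu T x hx t ht htT).2 δ hδ
      ((hθ δ hδ (norm_nonneg φ) ((norm_nonneg φ).trans hM) hM).trans hMt)
    linarith [h δ hδ.le le_rfl]
  obtain ⟨β, hβ, hQβ⟩ := TimeDelay.exists_classKL Q hbdd hsmall hlim
  refine ⟨β, μ, hβ, hμ, fun φ u hu => ⟨?_, fun T x hx t ht htT => ?_⟩⟩
  · refine TimeDelay.exists_global_solution hf hf0 hu
      (K := fun t => ‖φ‖ + κ ‖φ‖ + μ (TimeDelay.inputNorm u (max t 0))) (fun s t hst => ?_)
      (fun t => ?_) fun T x hx t ht htT => ?_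
    · exact add_le_add_right (hμ.mono (TimeDelay.inputNorm_nonneg _ _)
        (hu.inputNorm_mono (le_max_right _ _) (max_le_max_right 0 hst))) _
    · have h1 := hκ.nonneg (norm_nonneg φ)
      have h2 := hμ.nonneg (TimeDelay.inputNorm_nonneg u (max t 0))
      linarith
    · have := (hest φ u hu T x hx t ht htT).1
      rw [max_eq_left ht]
      linarith [norm_nonneg φ]
  · exact sub_le_iff_le_add.mp
      (hQβ _ _ _ ⟨φ, u, T, x, hu, hx, ht, htT, rfl, rfl⟩ (norm_nonneg φ))
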